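/- For $p>-1$ let $J_p$ be the self-adjoint Jacobi (Laguerre) operator in the complex Hilbert space $\ell^2(\mathbb{Z}_+)$, $\mathbb{Z}_+=\{0,1,2,\dots\}$, given by $$(J_pf)_n=a^{(p)}_{n-1}f_{n-1}+b^{(p)}_nf_n+a^{(p)}_nf_{n+1},\quad n\in\mathbb{Z}_+,\qquad a^{(p)}_{-1}=0,$$ $$a^{(p)}_n=\sqrt{(n+1)(n+1+p)},\qquad b^{(p)}_n=2n+p+1,$$ on the domain of all $f\in\ell^2(\mathbb{Z}_+)$ with $J_pf\in\ell^2(\mathbb{Z}_+)$. Then for all real $p,q>-1$ the wave operators $$W_\pm=W_\pm(J_q,J_p)=\operatorname*{s-lim}_{t\to\pm\infty}e^{iJ_qt}e^{-iJ_pt}$$ exist as strong limits of bounded operators on $\ell^2(\mathbb{Z}_+)$, and the scattering operator $S=W_+^*W_-$ is a constant multiple of the identity operator $I$: $$S=W_+^*W_-=e^{i(p-q)\pi}I.$$ -/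

import Mathlib

open Filter Topology

noncomputable section

/-- The Hilbert space `ℓ²(ℤ₊)` of square-summable complex sequences indexed by `0, 1, 2, …`. -/
abbrev EllTwo : Type := lp (fun _ : ℕ => ℂ) 2

/-- The Jacobi difference expression
`(J f)_n = a_{n-1} f_{n-1} + b_n f_n + a_n f_{n+1}`, with `a_{-1} = 0`,
acting on arbitrary complex sequences. -/
def jacobiExpr (a b : ℕ → ℝ) : (ℕ → ℂ) →ₗ[ℂ] (ℕ → ℂ) where
  toFun f n := (if n = 0 then 0 else (a (n - 1) : ℂ) * f (n - 1)) + b n * f n + a n * f (n + 1)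
  map_add' f g := by
    funext n
    by_cases h : n = 0 <;> simp [h] <;> ring
  map_smul' c f := by
    funext n
    by_cases h : n = 0 <;> simp [h] <;> ring

/-- The Jacobi operator in `ℓ²(ℤ₊)` with coefficients `a`, `b`: it acts by the Jacobi difference
expression, and its domain consists of all `f ∈ ℓ²` such that `J f ∈ ℓ²`. -/
def jacobiOperator (a b : ℕ → ℝ) : EllTwo →ₗ.[ℂ] EllTwo where
  domain :=
    { carrier := {f | Memℓp (jacobiExpr a b f) 2}
      add_mem' := fun {f g} hf hg => by
        have h := Memℓp.add (E := fun _ : ℕ => ℂ) hf hg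
        change Memℓp (jacobiExpr a b ((f : ℕ → ℂ) + (g : ℕ → ℂ))) 2
        rw [map_add]
        exact h
      zero_mem' := by
        change Memℓp (jacobiExpr a b (0 : ℕ → ℂ)) 2
        rw [map_zero]
        exact zero_memℓp
      smul_mem' := fun c f hf => by
        have h := Memℓp.const_smul (E := fun _ : ℕ => ℂ) hf c
        change Memℓp (jacobiExpr a b (c • (f : ℕ → ℂ))) 2
        rw [map_smul]
        exact h }
  toFun :=
    { toFun := fun f => ⟨jacobiExpr a b (f : EllTwo), f.2⟩
      map_add' := fun f g => Subtype.ext <|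
        (jacobiExpr a b).map_add ((f : EllTwo) : ℕ → ℂ) ((g : EllTwo) : ℕ → ℂ)
      map_smul' := fun c f => Subtype.ext <|
        (jacobiExpr a b).map_smul c ((f : EllTwo) : ℕ → ℂ) }

/-- The Laguerre operator `J_p`: the Jacobi operator with coefficients
`a_n = √((n + 1)(n + 1 + p))` and `b_n = 2 n + p + 1`. -/
def laguerreOperator (p : ℝ) : EllTwo →ₗ.[ℂ] EllTwo :=
  jacobiOperator (fun n => Real.sqrt (((n : ℝ) + 1) * ((n : ℝ) + 1 + p)))
    (fun n => 2 * (n : ℝ) + p + 1)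

section Scattering

variable {H : Type*} [NormedAddCommGroup H] [InnerProductSpace ℂ H] [CompleteSpace H]

/-- `U` is the unitary group `U t = e^{-i A t}`: a strongly continuous one-parameter group of
unitary operators whose infinitesimal generator is exactly `-i A`, that is, `f` lies in the domain
of `A` and `A f = g` if and only if `t ↦ U t f` has the derivative `-i g` at `t = 0`.
For a self-adjoint `A` there is exactly one such `U`, and if there is one, `A` is self-adjoint. -/
structure IsUnitaryGroupOf (A : H →ₗ.[ℂ] H) (U : ℝ → H →L[ℂ] H) : Prop where
  unitary : ∀ t, U t ∈ unitary (H →L[ℂ] H)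
  map_add : ∀ s t, U (s + t) = U s ∘L U t
  continuous : ∀ f, Continuous fun t => U t f
  generator : ∀ f g, (f, g) ∈ A.graph ↔ HasDerivAt (fun t => U t f) (-Complex.I • g) 0

open Classical in
/-- The operator `e^{-i A t}`; it is set to `0` if `-i A` generates no unitary group
(that is, if `A` is not self-adjoint). -/
def unitaryGroup (A : H →ₗ.[ℂ] H) (t : ℝ) : H →L[ℂ] H :=
  if h : ∃ U : ℝ → H →L[ℂ] H, IsUnitaryGroupOf A U then h.choose t else 0

/-- `W` is the strong limit of `e^{i B t} e^{-i A t}` along the filter `l`. For `l = atTop` this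
says that the wave operator `W₊(B, A)` exists and equals `W`, and for `l = atBot` that
`W₋(B, A)` exists and equals `W`. -/
def IsWaveOperator (B A : H →ₗ.[ℂ] H) (l : Filter ℝ) (W : H →L[ℂ] H) : Prop :=
  ∀ f, Tendsto (fun t : ℝ => unitaryGroup B (-t) (unitaryGroup A t f)) l (𝓝 (W f))

end Scattering

end

open ComplexConjugate

noncomputable section

/-! ### Total families: unitaries from Gram matrices, and strong limits from weak ones. -/

section HilbertSpace

variable {E F : Type*} [NormedAddCommGroup E] [InnerProductSpace ℂ E]
  [NormedAddCommGroup F] [InnerProductSpace ℂ F] {ι κ τ : Type*}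

/-! Put `a = p + 1`, `b = q + 1`. For `re w > 1/2` the coherent vector `e_w` of weight `a` has
coordinates `w^(-a) √((a)_n / n!) (1/w - 1)^n`. These vectors are total, and the binomial series
gives `⟨e_w, e_z⟩ = (conj w + z - 1)^(-a)`. Pairing a sequence with them turns the Laguerre
expression into `-d/dz` (`hasDerivAt_laguerreTransform`), so `e^{-iJt}` acts by the translation `e_w
↦ e_{w+it}` (`isUnitaryGroupOf_laguerreGroup`). The translations are unitary because the Gram kernel
is invariant under them.

Euler's Gamma integral gives the same kernel for the functions `Γ(a)^(-1/2) x^((a-1)/2)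
e^{-(w-1/2)x}` in `L²(0,∞)`. This yields a unitary spectral representation for each weight, in which
the group is multiplication by `e^{-itx}`. Composing one representation with the inverse of the
other gives a unitary `V` with explicit matrix elements (`exists_spectralIntertwiner`).

By translation, the matrix elements of `e^{iJ_q t} e^{-iJ_p t}` reduce to pairings of coherent
vectors of weights `b` and `a` at `w + it` and `z + it`. Such a pairing is a power series in `s =
(1/conj(w+it) - 1)(1/(z+it) - 1)` with coefficients asymptotic to a constant times those of
`(1-s)^(-(a+b)/2)`. As `|t| → ∞`, `s → 1` inside a Stolz angle, so Abel's theorem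
(`tendsto_tsum_div_cpow`) applies. Besides the matrix element of `V` there remains the factor
`(conj(w+it))^((a-b)/2) (z+it)^(-(a-b)/2)`, whose limit is the phase `e^{∓iπ(a-b)/2}` as `t → ±∞`.

Thus the weak limits are `W± = e^{∓iπ(p-q)/2} V`. They are isometric, so the convergence is strong
(`tendsto_of_tendsto_inner`). In `W₊* W₋` the unitary `V` cancels and the two phases combine to
`e^{iπ(p-q)}`. -/

theorem norm_linearCombination_eq_of_inner_eq (v : ι → E) (u : ι → F)
    (h : ∀ i j, inner ℂ (u i) (u j) = inner ℂ (v i) (v j)) (a : ι →₀ ℂ) :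
    ‖Finsupp.linearCombination ℂ u a‖ = ‖Finsupp.linearCombination ℂ v a‖ := by
  have : inner ℂ (Finsupp.linearCombination ℂ u a) (Finsupp.linearCombination ℂ u a)
      = inner ℂ (Finsupp.linearCombination ℂ v a) (Finsupp.linearCombination ℂ v a) := by
    simp only [Finsupp.linearCombination_apply, Finsupp.sum, sum_inner, inner_sum, inner_smul_left,
      inner_smul_right, h]
  rw [inner_self_eq_norm_sq_to_K, inner_self_eq_norm_sq_to_K] at this
  have h2 : ‖Finsupp.linearCombination ℂ u a‖ ^ 2 = ‖Finsupp.linearCombination ℂ v a‖ ^ 2 := by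
    exact_mod_cast this
  exact (sq_eq_sq₀ (norm_nonneg _) (norm_nonneg _)).1 h2

/-- Two total families with the same Gram matrix are related by a unitary operator. -/
theorem exists_linearIsometryEquiv_of_inner_eq [CompleteSpace E] [CompleteSpace F]
    (v : ι → E) (u : ι → F)
    (hv : Dense (Submodule.span ℂ (Set.range v) : Set E))
    (hu : Dense (Submodule.span ℂ (Set.range u) : Set F))
    (h : ∀ i j, inner ℂ (u i) (u j) = inner ℂ (v i) (v j)) :
    ∃ T : E ≃ₗᵢ[ℂ] F, ∀ i, T (v i) = u i := by
  have hv' : DenseRange (Finsupp.linearCombination ℂ v) := by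
    rwa [DenseRange, ← LinearMap.coe_range, Finsupp.range_linearCombination]
  have hu' : DenseRange (Finsupp.linearCombination ℂ u) := by
    rwa [DenseRange, ← LinearMap.coe_range, Finsupp.range_linearCombination]
  have hn : ∀ a, ‖Finsupp.linearCombination ℂ u (LinearEquiv.refl ℂ (ι →₀ ℂ) a)‖ =
      ‖Finsupp.linearCombination ℂ v a‖ := norm_linearCombination_eq_of_inner_eq v u h
  refine ⟨(LinearEquiv.refl ℂ (ι →₀ ℂ)).extendOfIsometry (Finsupp.linearCombination ℂ v)
    (Finsupp.linearCombination ℂ u) hv' hu' hn, fun i => ?_⟩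
  rw [LinearEquiv.extendOfIsometry_apply]
  have := LinearMap.extendOfNorm_eq (f := Finsupp.linearCombination ℂ u ∘ₗ
    (LinearEquiv.refl ℂ (ι →₀ ℂ)).toLinearMap) hv'
    ⟨1, fun x => by simpa using (hn x).le⟩ (Finsupp.single i 1)
  simpa using this

theorem dense_span_of_forall_inner_eq_zero [CompleteSpace E] (v : ι → E)
    (h : ∀ x, (∀ i, inner ℂ (v i) x = 0) → x = 0) :
    Dense (Submodule.span ℂ (Set.range v) : Set E) := by
  rw [Submodule.dense_iff_topologicalClosure_eq_top, Submodule.topologicalClosure_eq_top_iff,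
    Submodule.eq_bot_iff]
  intro x hx
  exact h x fun i => (Submodule.mem_orthogonal _ x).1 hx _ (Submodule.subset_span ⟨i, rfl⟩)

theorem eq_of_forall_inner_eq_of_dense_span {v : ι → E}
    (hv : Dense (Submodule.span ℂ (Set.range v) : Set E)) {x y : E}
    (h : ∀ i, inner ℂ (v i) x = inner ℂ (v i) y) : x = y := by
  refine hv.eq_of_inner_right (𝕜 := ℂ) fun z hz => ?_
  induction hz using Submodule.span_induction with
  | mem z hz => obtain ⟨i, rfl⟩ := hz; exact h i
  | zero => simp
  | add a b _ _ ha hb => rw [inner_add_left, inner_add_left, ha, hb]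
  | smul c a _ ha => rw [inner_smul_left, inner_smul_left, ha]

/-- Pointwise convergence of a bounded family of operators may be checked on a total family. -/
theorem tendsto_of_dense_span {G : Type*} [NormedAddCommGroup G] [NormedSpace ℂ G] {l : Filter τ}
    (T : τ → E →L[ℂ] G) (S : E →L[ℂ] G) (C : ℝ) (hT : ∀ t x, ‖T t x‖ ≤ C * ‖x‖) {v : ι → E}
    (hv : Dense (Submodule.span ℂ (Set.range v) : Set E))
    (h : ∀ i, Tendsto (fun t => T t (v i)) l (𝓝 (S (v i)))) (x : E) :
    Tendsto (fun t => T t x) l (𝓝 (S x)) := by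
  have hspan : ∀ y ∈ Submodule.span ℂ (Set.range v), Tendsto (fun t => T t y) l (𝓝 (S y)) := by
    intro y hy
    induction hy using Submodule.span_induction with
    | mem z hz => obtain ⟨i, rfl⟩ := hz; exact h i
    | zero => simpa using tendsto_const_nhds
    | add a b _ _ ha hb => simpa using ha.add hb
    | smul c a _ ha => simpa using ha.const_smul c
  rw [Metric.tendsto_nhds]
  intro ε hε
  set D : ℝ := |C| + ‖S‖ + 1 with hD
  have hDpos : 0 < D := by positivity
  obtain ⟨y, hy, hxy⟩ := Metric.mem_closure_iff.1 (hv x) (ε / (2 * D)) (by positivity)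
  filter_upwards [Metric.tendsto_nhds.1 (hspan y hy) (ε / 2) (by positivity)] with t ht
  rw [dist_eq_norm] at *
  have h1 : T t x - S x = (T t y - S y) + (T t (x - y) - S (x - y)) := by
    simp only [map_sub]; abel
  have h2 : ‖T t (x - y)‖ ≤ |C| * ‖x - y‖ :=
    (hT t _).trans (mul_le_mul_of_nonneg_right (le_abs_self C) (norm_nonneg _))
  have h3 : ‖S (x - y)‖ ≤ ‖S‖ * ‖x - y‖ := S.le_opNorm _
  have h4 : D * ‖x - y‖ < ε / 2 := by
    have := mul_lt_mul_of_pos_left hxy hDpos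
    calc D * ‖x - y‖ < D * (ε / (2 * D)) := this
      _ = ε / 2 := by field_simp
  have h5 := norm_add_le (T t y - S y) (T t (x - y) - S (x - y))
  have h6 := norm_sub_le (T t (x - y)) (S (x - y))
  rw [h1]
  have h7 : D * ‖x - y‖ = |C| * ‖x - y‖ + ‖S‖ * ‖x - y‖ + ‖x - y‖ := by rw [hD]; ring
  have := norm_nonneg (x - y)
  linarith

/-- A family of isometric operators converges strongly to an isometric operator as soon as
its matrix elements between two total families converge. -/
theorem tendsto_of_tendsto_inner {l : Filter τ} (T : τ → E →L[ℂ] F) (S : E →L[ℂ] F)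
    (hT : ∀ t x, ‖T t x‖ = ‖x‖) (hS : ∀ x, ‖S x‖ = ‖x‖) {v : ι → E} {u : κ → F}
    (hv : Dense (Submodule.span ℂ (Set.range v) : Set E))
    (hu : Dense (Submodule.span ℂ (Set.range u) : Set F))
    (h : ∀ i j, Tendsto (fun t => inner ℂ (T t (v i)) (u j)) l (𝓝 (inner ℂ (S (v i)) (u j))))
    (x : E) : Tendsto (fun t => T t x) l (𝓝 (S x)) := by
  refine tendsto_of_dense_span T S 1 (fun t x => by rw [hT, one_mul]) hv (fun i => ?_) x
  -- Weak convergence extends to the test vector `S (v i)` itself; since all norms agree, expanding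
  -- `‖T t (v i) - S (v i)‖²` then gives norm convergence.
  have hw := tendsto_of_dense_span (fun t => innerSL ℂ (T t (v i))) (innerSL ℂ (S (v i))) ‖v i‖
    (fun t y => by simpa [hT] using norm_inner_le_norm (𝕜 := ℂ) (T t (v i)) y) hu
    (fun j => by simpa using h i j) (S (v i))
  simp only [innerSL_apply_apply] at hw
  rw [tendsto_iff_norm_sub_tendsto_zero]
  have hsq : Tendsto (fun t => ‖T t (v i) - S (v i)‖ ^ 2) l (𝓝 0) := by
    have h1 := (Complex.continuous_re.tendsto _).comp hw
    have h2 : Tendsto (fun t => ‖v i‖ ^ 2 - 2 * (inner ℂ (T t (v i)) (S (v i))).re + ‖v i‖ ^ 2) l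
        (𝓝 (‖v i‖ ^ 2 - 2 * (inner ℂ (S (v i)) (S (v i))).re + ‖v i‖ ^ 2)) :=
      (tendsto_const_nhds.sub (h1.const_mul 2)).add tendsto_const_nhds
    have h3 : (inner ℂ (S (v i)) (S (v i))).re = ‖v i‖ ^ 2 := by
      rw [← hS (v i)]; exact inner_self_eq_norm_sq (𝕜 := ℂ) (S (v i))
    rw [h3] at h2
    convert h2 using 2
    · rename_i t
      have := norm_sub_sq (𝕜 := ℂ) (T t (v i)) (S (v i))
      rw [hT, hS] at this
      exact this
    · ring
  have := hsq.sqrt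
  simpa using this

/-- A curve is differentiable with a given continuous derivative as soon as its inner products with
a total family are. -/
theorem hasDerivAt_of_hasDerivAt_inner [CompleteSpace E] {x : ι → E}
    (hx : Dense (Submodule.span ℂ (Set.range x) : Set E)) {u v : ℝ → E} (hv : Continuous v)
    (h : ∀ i t, HasDerivAt (fun s => inner ℂ (x i) (u s)) (inner ℂ (x i) (v t)) t) (t : ℝ) :
    HasDerivAt u (v t) t := by
  have hd : ∀ s, HasDerivAt (fun s => ∫ r in (0 : ℝ)..s, v r) (v s) s := fun s =>
    intervalIntegral.integral_hasDerivAt_right (hv.intervalIntegrable _ _)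
      hv.stronglyMeasurable.stronglyMeasurableAtFilter hv.continuousAt
  -- The weak derivative determines `u` as the primitive of `v`; the fundamental theorem of calculus
  -- then makes the derivative strong.
  have key : ∀ s, u s = u 0 + ∫ r in (0 : ℝ)..s, v r := by
    intro s
    refine eq_of_forall_inner_eq_of_dense_span hx fun i => ?_
    have h1 : ∀ r, HasDerivAt (fun s => inner ℂ (x i) (u s) -
        inner ℂ (x i) (u 0 + ∫ r in (0 : ℝ)..s, v r)) 0 r := by
      intro r
      have h2 := ((innerSL ℂ (x i)).restrictScalars ℝ).hasFDerivAt.comp_hasDerivAt r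
        ((hd r).const_add (u 0))
      have h3 := (h i r).sub h2
      simp only [ContinuousLinearMap.coe_restrictScalars', innerSL_apply_apply, sub_self] at h3
      exact h3
    have h3 := is_const_of_deriv_eq_zero (fun r => (h1 r).differentiableAt)
      (fun r => (h1 r).deriv) s 0
    simp only [intervalIntegral.integral_same, add_zero, sub_self] at h3
    exact sub_eq_zero.1 h3
  have := (hd t).const_add (u 0)
  exact this.congr_of_eventuallyEq (Eventually.of_forall key)

end HilbertSpace

/-! ### Uniqueness of the unitary group with a given generator. -/

section UnitaryGroup

variable {H : Type*} [NormedAddCommGroup H] [InnerProductSpace ℂ H] [CompleteSpace H]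
  {A : H →ₗ.[ℂ] H} {U V : ℝ → H →L[ℂ] H}

theorem inner_apply_apply_of_mem_unitary {T : H →L[ℂ] H} (hT : T ∈ unitary (H →L[ℂ] H)) (x y : H) :
    inner ℂ (T x) (T y) = inner ℂ x y := by
  have h := (Unitary.mem_iff.1 hT).1
  rw [← ContinuousLinearMap.adjoint_inner_right, ← ContinuousLinearMap.star_eq_adjoint]
  have : (star T) (T y) = (star T * T) y := rfl
  rw [this, h]; rfl

theorem norm_apply_of_mem_unitary {T : H →L[ℂ] H} (hT : T ∈ unitary (H →L[ℂ] H)) (x : H) :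
    ‖T x‖ = ‖x‖ := by
  have h := inner_apply_apply_of_mem_unitary hT x x
  rw [inner_self_eq_norm_sq_to_K, inner_self_eq_norm_sq_to_K] at h
  exact (sq_eq_sq₀ (norm_nonneg _) (norm_nonneg _)).1 (by exact_mod_cast h)

namespace IsUnitaryGroupOf

theorem apply_zero (hU : IsUnitaryGroupOf A U) (x : H) : U 0 x = x := by
  have h : U 0 (U 0 x) = U 0 x := by
    have := congrArg (fun T : H →L[ℂ] H => T x) (hU.map_add 0 0)
    simpa using this.symm
  have h2 : ‖U 0 x - x‖ = 0 := by
    rw [← norm_apply_of_mem_unitary (hU.unitary 0), map_sub, h, sub_self, norm_zero]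
  exact sub_eq_zero.1 (norm_eq_zero.1 h2)

theorem apply_add (hU : IsUnitaryGroupOf A U) (s t : ℝ) (x : H) : U (s + t) x = U s (U t x) := by
  rw [hU.map_add]; rfl

theorem inner_apply_neg (hU : IsUnitaryGroupOf A U) (t : ℝ) (x y : H) :
    inner ℂ (U (-t) x) y = inner ℂ x (U t y) := by
  rw [← inner_apply_apply_of_mem_unitary (hU.unitary t), ← hU.apply_add, add_neg_cancel,
    hU.apply_zero]

theorem hasDerivAt (hU : IsUnitaryGroupOf A U) {f g : H} (h : (f, g) ∈ A.graph) (t : ℝ) :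
    HasDerivAt (fun s => U s f) (-Complex.I • U t g) t := by
  have h0 := (hU.generator f g).1 h
  have h1 : HasDerivAt (fun s : ℝ => U (s - t) f) (-Complex.I • g) t := by
    have := HasDerivAt.scomp (g₁ := fun s => U s f) t (by simpa using h0)
      ((hasDerivAt_id t).sub_const t)
    simpa [Function.comp_def] using this
  have h2 := ((U t).restrictScalars ℝ).hasFDerivAt.comp_hasDerivAt t h1
  have h3 : (fun s => U s f) = fun s => U t (U (s - t) f) := by
    funext s; rw [← hU.apply_add]; congr 2; ring
  rw [h3]
  simpa [Function.comp_def] using h2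

theorem apply_mem_graph (hU : IsUnitaryGroupOf A U) {f g : H} (h : (f, g) ∈ A.graph) (t : ℝ) :
    (U t f, U t g) ∈ A.graph := by
  rw [hU.generator]
  have h2 := ((U t).restrictScalars ℝ).hasFDerivAt.comp_hasDerivAt 0 ((hU.generator f g).1 h)
  have h3 : (fun s => U s (U t f)) = fun s => U t (U s f) := by
    funext s; rw [← hU.apply_add, ← hU.apply_add, add_comm]
  rw [h3]
  simpa [Function.comp_def] using h2

/-- The function `t ↦ ⟨U t f, U t f'⟩` is constant; its derivative at `0` is the asserted difference
up to a factor `I`. -/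
theorem symmetric (hU : IsUnitaryGroupOf A U) {f g f' g' : H} (h : (f, g) ∈ A.graph)
    (h' : (f', g') ∈ A.graph) : inner ℂ g f' = inner ℂ f g' := by
  have h1 := (hU.hasDerivAt h 0).inner ℂ (hU.hasDerivAt h' 0)
  simp only [inner_apply_apply_of_mem_unitary (hU.unitary _), hU.apply_zero, inner_smul_left,
    inner_smul_right] at h1
  have h2 := h1.unique (hasDerivAt_const (0 : ℝ) (inner ℂ f f'))
  rw [map_neg, Complex.conj_I] at h2
  have h3 : Complex.I * (inner ℂ g f' - inner ℂ f g') = 0 := by linear_combination h2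
  simpa [sub_eq_zero] using h3

/-- Symmetry of the generator makes `⟨U t f, V t f⟩` constant, hence equal to `‖f‖²`; for two
vectors of norm `‖f‖` this forces equality. -/
theorem apply_eq_of_mem_graph (hU : IsUnitaryGroupOf A U) (hV : IsUnitaryGroupOf A V) {f g : H}
    (h : (f, g) ∈ A.graph) (t : ℝ) : U t f = V t f := by
  have hd : ∀ s, HasDerivAt (fun s => inner ℂ (U s f) (V s f)) 0 s := by
    intro s
    have h1 := (hU.hasDerivAt h s).inner ℂ (hV.hasDerivAt h s)
    have h2 : inner ℂ (U s f) (-Complex.I • V s g) + inner ℂ (-Complex.I • U s g) (V s f) = 0 := by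
      rw [inner_smul_left, inner_smul_right, map_neg, Complex.conj_I,
        hU.symmetric (hU.apply_mem_graph h s) (hV.apply_mem_graph h s)]
      ring
    rwa [h2] at h1
  have hc := is_const_of_deriv_eq_zero (fun r => (hd r).differentiableAt)
      (fun r => (hd r).deriv) t 0
  simp only [hU.apply_zero, hV.apply_zero] at hc
  have hn := norm_sub_sq (𝕜 := ℂ) (U t f) (V t f)
  rw [hc, norm_apply_of_mem_unitary (hU.unitary t), norm_apply_of_mem_unitary (hV.unitary t),
    inner_self_eq_norm_sq] at hn
  have : ‖U t f - V t f‖ ^ 2 = 0 := by rw [hn]; ring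
  exact sub_eq_zero.1 (norm_eq_zero.1 (pow_eq_zero_iff two_ne_zero |>.1 this))

theorem hasDerivAt_integral (hU : IsUnitaryGroupOf A U) (f : H) (t : ℝ) :
    HasDerivAt (fun s => ∫ r in (0 : ℝ)..s, U r f) (U t f) t :=
  intervalIntegral.integral_hasDerivAt_right ((hU.continuous f).intervalIntegrable _ _)
    (hU.continuous f).stronglyMeasurable.stronglyMeasurableAtFilter (hU.continuous f).continuousAt

/-- Time integrals of an orbit lie in the domain. They carry the comparison of two groups from the
domain to arbitrary vectors, without a separate density argument. -/
theorem integral_mem_graph (hU : IsUnitaryGroupOf A U) (f : H) (h : ℝ) :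
    (∫ r in (0 : ℝ)..h, U r f, Complex.I • (U h f - U 0 f)) ∈ A.graph := by
  have hi := fun x y => (hU.continuous f).intervalIntegrable (μ := MeasureTheory.volume) x y
  have e : (fun t => U t (∫ r in (0 : ℝ)..h, U r f)) =
      fun t => (∫ r in (0 : ℝ)..(t + h), U r f) - ∫ r in (0 : ℝ)..t, U r f := by
    funext t
    rw [← ContinuousLinearMap.intervalIntegral_comp_comm _ (hi 0 h)]
    simp only [← hU.apply_add]
    rw [intervalIntegral.integral_comp_add_left (fun s => U s f), add_zero,
      intervalIntegral.integral_interval_sub_left (hi _ _) (hi _ _)]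
  rw [hU.generator, e]
  have h1 := (hU.hasDerivAt_integral f (0 + h)).comp_add_const 0 h
  have h2 := h1.sub (hU.hasDerivAt_integral f 0)
  rw [zero_add] at h2
  rw [smul_smul, neg_mul, Complex.I_mul_I, neg_neg, one_smul]
  exact h2

/-- A self-adjoint operator generates only one unitary group. -/
theorem unique (hU : IsUnitaryGroupOf A U) (hV : IsUnitaryGroupOf A V) (t : ℝ) : U t = V t := by
  ext f
  -- The groups agree on every integral `∫₀ˢ U r f`; differentiating at `s = 0` recovers `f`.
  have h1 := ((U t).restrictScalars ℝ).hasFDerivAt.comp_hasDerivAt 0 (hU.hasDerivAt_integral f 0)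
  have h2 := ((V t).restrictScalars ℝ).hasFDerivAt.comp_hasDerivAt 0 (hU.hasDerivAt_integral f 0)
  have e : ((U t).restrictScalars ℝ) ∘ (fun s => ∫ r in (0 : ℝ)..s, U r f) =
      ((V t).restrictScalars ℝ) ∘ fun s => ∫ r in (0 : ℝ)..s, U r f := by
    funext s
    exact hU.apply_eq_of_mem_graph hV (hU.integral_mem_graph f s) t
  rw [e] at h1
  simpa [hU.apply_zero] using h1.unique h2

theorem isUnitaryGroupOf_unitaryGroup (hU : IsUnitaryGroupOf A U) :
    IsUnitaryGroupOf A (unitaryGroup A) := by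
  have h : ∃ U : ℝ → H →L[ℂ] H, IsUnitaryGroupOf A U := ⟨U, hU⟩
  have h2 : unitaryGroup A = h.choose := by
    funext t; rw [unitaryGroup, dif_pos h]
  rw [h2]
  exact h.choose_spec

end IsUnitaryGroupOf

end UnitaryGroup

/-! ### Binomial series and power series on the unit disk. -/

section PowerSeries

/-- The binomial coefficients `(a)_n / n!`, i.e. the Taylor coefficients of `(1 - s) ^ (-a)`. -/
def binomCoeff (a : ℝ) (n : ℕ) : ℝ := ∏ j ∈ Finset.range n, (a + j) / (j + 1)

theorem binomCoeff_zero (a : ℝ) : binomCoeff a 0 = 1 := by simp [binomCoeff]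

theorem binomCoeff_succ (a : ℝ) (n : ℕ) :
    binomCoeff a (n + 1) = binomCoeff a n * ((a + n) / (n + 1)) := by
  rw [binomCoeff, Finset.prod_range_succ, binomCoeff]

theorem binomCoeff_pos {a : ℝ} (ha : 0 < a) (n : ℕ) : 0 < binomCoeff a n :=
  Finset.prod_pos fun j _ => by positivity

theorem choose_eq_binomCoeff (a : ℝ) (n : ℕ) :
    Ring.choose ((a : ℂ) + n - 1) n = (binomCoeff a n : ℂ) := by
  have h1 : Ring.choose ((a : ℂ) + n - 1) n = Ring.multichoose (a : ℂ) n := by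
    rw [Ring.choose]; congr 1; ring
  have h2 : ∀ n, (ascPochhammer ℕ n).smeval (a : ℂ) = (n.factorial : ℂ) * (binomCoeff a n : ℂ) := by
    intro n
    induction n with
    | zero => simp [binomCoeff_zero]
    | succ n ih =>
      rw [ascPochhammer_succ_right, Polynomial.smeval_mul, ih, binomCoeff_succ, Nat.factorial_succ,
        Polynomial.smeval_add, Polynomial.smeval_X, Polynomial.smeval_natCast]
      have : ((n : ℂ) + 1) ≠ 0 := by exact_mod_cast n.succ_ne_zero
      push_cast
      field_simp
      simp
  have h3 := Ring.factorial_nsmul_multichoose_eq_ascPochhammer (a : ℂ) n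
  rw [h2, nsmul_eq_mul] at h3
  rw [h1]
  exact mul_left_cancel₀ (by exact_mod_cast n.factorial_ne_zero) h3

theorem hasSum_binomCoeff (a : ℝ) {s : ℂ} (hs : ‖s‖ < 1) :
    HasSum (fun n => (binomCoeff a n : ℂ) * s ^ n) ((1 - s) ^ (-(a : ℂ))) := by
  have h := (Complex.one_div_one_sub_cpow_hasFPowerSeriesOnBall_zero (a : ℂ)).hasSum
    (y := s) (by simpa [enorm_eq_nnnorm, ← NNReal.coe_lt_coe] using hs)
  simp only [zero_add, FormalMultilinearSeries.ofScalars_apply_eq, choose_eq_binomCoeff,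
    smul_eq_mul, one_div, ← Complex.cpow_neg] at h
  exact h

theorem hasSum_binomCoeff_real (a : ℝ) {r : ℝ} (h0 : 0 ≤ r) (hr : r < 1) :
    HasSum (fun n => binomCoeff a n * r ^ n) ((1 - r) ^ (-a)) := by
  have h := hasSum_binomCoeff a (s := (r : ℂ)) (by simpa [abs_of_nonneg h0] using hr)
  rw [← Complex.ofReal_neg, ← Complex.ofReal_one, ← Complex.ofReal_sub,
    ← Complex.ofReal_cpow (by linarith)] at h
  exact_mod_cast h

/-- Summability of the power series with coefficients `e` on the open unit disk. -/
def DiskSummable (e : ℕ → ℂ) : Prop := ∀ x : ℂ, ‖x‖ < 1 → Summable fun n => e n * x ^ n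

theorem DiskSummable.summable_norm {e : ℕ → ℂ} (he : DiskSummable e) {r : ℝ} (h0 : 0 ≤ r)
    (hr : r < 1) : Summable fun n => ‖e n‖ * r ^ n := by
  have := (he (r : ℂ) (by simpa [abs_of_nonneg h0] using hr)).norm
  simpa [abs_of_nonneg h0] using this

theorem hasSum_deriv_of_diskSummable {e : ℕ → ℂ} (he : DiskSummable e) {x : ℂ} (hx : ‖x‖ < 1) :
    ∃ D, HasDerivAt (fun x => ∑' n, e n * x ^ n) D x ∧
      HasSum (fun n : ℕ => ((n : ℂ) + 1) * e (n + 1) * x ^ n) D := by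
  obtain ⟨r, hxr, hr1⟩ := exists_between hx
  have h0 : 0 ≤ r := (norm_nonneg x).trans hxr.le
  have hu := he.summable_norm h0 hr1
  have hxb : x ∈ Metric.ball (0 : ℂ) r := by simpa using hxr
  have hle : ∀ (i : ℕ) (w : ℂ), w ∈ Metric.ball (0 : ℂ) r → ‖e i * w ^ i‖ ≤ ‖e i‖ * r ^ i := by
    intro i w hw
    have hw' : ‖w‖ ≤ r := by simpa using (Metric.mem_ball.1 hw).le
    rw [norm_mul, norm_pow]
    gcongr
  have hd : ∀ i : ℕ, DifferentiableOn ℂ (fun w => e i * w ^ i) (Metric.ball 0 r) :=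
    fun i => by fun_prop
  have h1 := Complex.hasSum_deriv_of_summable_norm hu hd Metric.isOpen_ball hle hxb
  have h2 := (Complex.differentiableOn_tsum_of_summable_norm hu hd Metric.isOpen_ball hle)
    |>.differentiableAt (Metric.isOpen_ball.mem_nhds hxb)
  refine ⟨_, h2.hasDerivAt, ?_⟩
  have h3 := (hasSum_nat_add_iff' 1).2 h1
  simp only [Finset.sum_range_one, pow_zero, mul_one, deriv_const', sub_zero] at h3
  have h4 : (fun n : ℕ => ((n : ℂ) + 1) * e (n + 1) * x ^ n) =
      fun n => deriv (fun w => e (n + 1) * w ^ (n + 1)) x := by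
    funext n
    simp
    ring
  rw [h4]
  exact h3

theorem eq_zero_of_forall_tsum_eq_zero {e : ℕ → ℂ} (he : DiskSummable e)
    (h : ∀ x : ℂ, ‖x‖ < 1 → ∑' n, e n * x ^ n = 0) : e = 0 := by
  have hp : HasFPowerSeriesOnBall (fun _ : ℂ => (0 : ℂ)) (FormalMultilinearSeries.ofScalars ℂ e) 0
      (ENNReal.ofReal (1 / 2)) := by
    refine ⟨?_, by simp, ?_⟩
    · refine FormalMultilinearSeries.le_radius_of_summable _ ?_
      simp only [FormalMultilinearSeries.ofScalars_norm]
      exact he.summable_norm (by positivity) (by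
        rw [Real.coe_toNNReal _ (by norm_num)]; norm_num)
    · intro y hy
      have hy1 : ‖y‖ < 1 := by
        have : y ∈ Metric.eball (0 : ℂ) (ENNReal.ofReal (1 / 2)) := hy
        rw [Metric.eball_ofReal] at this
        have : ‖y‖ < 1 / 2 := by simpa using this
        linarith
      simp only [FormalMultilinearSeries.ofScalars_apply_eq, smul_eq_mul]
      rw [← h y hy1]
      exact (he y hy1).hasSum
  have h0 : FormalMultilinearSeries.ofScalars ℂ e = 0 :=
    HasFPowerSeriesAt.eq_zero hp.hasFPowerSeriesAt
  exact (FormalMultilinearSeries.ofScalars_series_eq_zero ℂ).1 h0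

end PowerSeries

/-! ### The conformal map `z ↦ 1/z - 1` from the half-plane to the disk. -/

section HalfPlane

theorem norm_inv_sub_one_lt_one_iff {z : ℂ} (hz : z ≠ 0) : ‖z⁻¹ - 1‖ < 1 ↔ 1 / 2 < z.re := by
  have h1 : z⁻¹ - 1 = (1 - z) / z := by field_simp
  rw [h1, norm_div, div_lt_one (norm_pos_iff.2 hz), ← sq_lt_sq₀ (norm_nonneg _) (norm_nonneg _),
    ← Complex.normSq_eq_norm_sq, ← Complex.normSq_eq_norm_sq, Complex.normSq_apply,
    Complex.normSq_apply]
  simp only [Complex.sub_re, Complex.one_re, Complex.sub_im, Complex.one_im]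
  constructor <;> intro h <;> nlinarith

theorem ne_zero_of_half_lt_re {z : ℂ} (hz : 1 / 2 < z.re) : z ≠ 0 := by
  rintro rfl
  norm_num at hz

theorem one_sub_mul_inv_sub_one {z w : ℂ} (hz : z ≠ 0) (hw : w ≠ 0) :
    1 - (z⁻¹ - 1) * (w⁻¹ - 1) = (z + w - 1) / (z * w) := by
  field_simp
  ring

/-- The exponentials of the two sides agree, so they differ by `2πik`. All four arguments involved
are smaller than `π/2` in absolute value, so `|2πk| < 2π` and `k = 0`. -/
theorem log_one_sub_mul_inv_sub_one {z w : ℂ} (hz : 1 / 2 < z.re) (hw : 1 / 2 < w.re) :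
    Complex.log (1 - (z⁻¹ - 1) * (w⁻¹ - 1)) =
      Complex.log (z + w - 1) - Complex.log z - Complex.log w := by
  have hz0 := ne_zero_of_half_lt_re hz
  have hw0 := ne_zero_of_half_lt_re hw
  have hD : 0 < (z + w - 1).re := by simp; linarith
  have hD0 : z + w - 1 ≠ 0 := fun h => by simp [h] at hD
  set s := (z⁻¹ - 1) * (w⁻¹ - 1) with hs
  have hs1 : ‖s‖ < 1 := by
    rw [hs, norm_mul]
    exact mul_lt_one_of_nonneg_of_lt_one_left (norm_nonneg _)
      ((norm_inv_sub_one_lt_one_iff hz0).2 hz) ((norm_inv_sub_one_lt_one_iff hw0).2 hw).le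
  have hsre : 0 < (1 - s).re := by
    have := (Complex.re_le_norm s)
    simp; linarith
  have hs0 : 1 - s ≠ 0 := fun h => by simp [h] at hsre
  have e1 := abs_lt.1 (Complex.abs_arg_lt_pi_div_two_iff.2 (Or.inl hD))
  have e2 := abs_lt.1 (Complex.abs_arg_lt_pi_div_two_iff.2 (Or.inl hsre))
  have e3 := abs_lt.1 (Complex.abs_arg_lt_pi_div_two_iff.2 (Or.inl (by linarith : 0 < z.re)))
  have e4 := abs_lt.1 (Complex.abs_arg_lt_pi_div_two_iff.2 (Or.inl (by linarith : 0 < w.re)))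
  have hexp : Complex.exp (Complex.log (1 - s) + Complex.log z + Complex.log w
      - Complex.log (z + w - 1)) = 1 := by
    rw [Complex.exp_sub, Complex.exp_add, Complex.exp_add, Complex.exp_log hs0,
      Complex.exp_log hz0, Complex.exp_log hw0, Complex.exp_log hD0, hs,
      one_sub_mul_inv_sub_one hz0 hw0]
    field_simp
  obtain ⟨k, hk⟩ := Complex.exp_eq_one_iff.1 hexp
  have him := congrArg Complex.im hk
  simp only [Complex.sub_im, Complex.add_im, Complex.log_im, Complex.mul_im, Complex.intCast_re,
    Complex.intCast_im, Complex.mul_re, Complex.re_ofNat, Complex.im_ofNat, Complex.ofReal_re,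
    Complex.ofReal_im, Complex.I_re, Complex.I_im, mul_zero, mul_one, zero_mul, add_zero,
    sub_zero] at him
  have hpi := Real.pi_pos
  have hk0 : k = 0 := by
    have h1 : (k : ℝ) * (2 * Real.pi) < 1 * (2 * Real.pi) := by linarith
    have h2 : (-1) * (2 * Real.pi) < (k : ℝ) * (2 * Real.pi) := by linarith
    have h3 := lt_of_mul_lt_mul_right h1 (by positivity)
    have h4 := lt_of_mul_lt_mul_right h2 (by positivity)
    have h5 : k < 1 := by exact_mod_cast h3
    have h6 : -1 < k := by exact_mod_cast h4
    omega
  rw [hk0] at hk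
  simp only [Int.cast_zero, zero_mul] at hk
  linear_combination hk

theorem one_sub_mul_inv_sub_one_cpow {z w : ℂ} (hz : 1 / 2 < z.re) (hw : 1 / 2 < w.re) (a : ℂ) :
    (1 - (z⁻¹ - 1) * (w⁻¹ - 1)) ^ (-a) = (z + w - 1) ^ (-a) * z ^ a * w ^ a := by
  have hz0 := ne_zero_of_half_lt_re hz
  have hw0 := ne_zero_of_half_lt_re hw
  have hD : 0 < (z + w - 1).re := by simp; linarith
  have hD0 : z + w - 1 ≠ 0 := fun h => by simp [h] at hD
  have hs0 : 1 - (z⁻¹ - 1) * (w⁻¹ - 1) ≠ 0 := by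
    rw [one_sub_mul_inv_sub_one hz0 hw0]
    exact div_ne_zero hD0 (mul_ne_zero hz0 hw0)
  rw [Complex.cpow_def_of_ne_zero hs0, Complex.cpow_def_of_ne_zero hD0,
    Complex.cpow_def_of_ne_zero hz0, Complex.cpow_def_of_ne_zero hw0,
    log_one_sub_mul_inv_sub_one hz hw, ← Complex.exp_add, ← Complex.exp_add]
  congr 1
  ring

theorem norm_mul_inv_sub_one_lt_one {z w : ℂ} (hz : 1 / 2 < z.re) (hw : 1 / 2 < w.re) :
    ‖(z⁻¹ - 1) * (w⁻¹ - 1)‖ < 1 := by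
  rw [norm_mul]
  exact mul_lt_one_of_nonneg_of_lt_one_left (norm_nonneg _)
    ((norm_inv_sub_one_lt_one_iff (ne_zero_of_half_lt_re hz)).2 hz)
    ((norm_inv_sub_one_lt_one_iff (ne_zero_of_half_lt_re hw)).2 hw).le

end HalfPlane

/-! ### The Laguerre expression as the derivative `-d/dz`. -/

section LaguerreTransform

/-- The Laguerre difference expression. -/
def laguerreExpr (p : ℝ) : (ℕ → ℂ) →ₗ[ℂ] (ℕ → ℂ) :=
  jacobiExpr (fun n => Real.sqrt (((n : ℝ) + 1) * ((n : ℝ) + 1 + p))) (fun n => 2 * (n : ℝ) + p + 1)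

/-- The norms of the weighted monomials in the lowest weight representation of weight `a`. -/
def weightCoeff (a : ℝ) (n : ℕ) : ℝ := Real.sqrt (binomCoeff a n)

theorem weightCoeff_pos {a : ℝ} (ha : 0 < a) (n : ℕ) : 0 < weightCoeff a n :=
  Real.sqrt_pos.2 (binomCoeff_pos ha n)

theorem weightCoeff_sq {a : ℝ} (ha : 0 < a) (n : ℕ) : weightCoeff a n ^ 2 = binomCoeff a n :=
  Real.sq_sqrt (binomCoeff_pos ha n).le

/-- Together with `sqrt_mul_weightCoeff_succ`, this removes the square roots from the recurrence:
weighted by `weightCoeff`, the Jacobi expression has coefficients affine in `n`. -/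
theorem sqrt_mul_weightCoeff {a : ℝ} (ha : 0 < a) (n : ℕ) :
    Real.sqrt (((n : ℝ) + 1) * ((n : ℝ) + 1 + (a - 1))) * weightCoeff a n =
      (n + 1) * weightCoeff a (n + 1) := by
  have h := (binomCoeff_pos ha n).le
  rw [weightCoeff, weightCoeff, binomCoeff_succ, ← Real.sqrt_mul (by
    have : (0 : ℝ) ≤ n := n.cast_nonneg
    apply mul_nonneg <;> linarith)]
  have e := Real.sqrt_sq (show (0 : ℝ) ≤ n + 1 by positivity)
  refine Eq.trans ?_ (congrArg (· * _) e)
  rw [← Real.sqrt_mul (by positivity)]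
  congr 1
  field_simp
  ring

theorem sqrt_mul_weightCoeff_succ {a : ℝ} (ha : 0 < a) (n : ℕ) :
    Real.sqrt (((n : ℝ) + 1) * ((n : ℝ) + 1 + (a - 1))) * weightCoeff a (n + 1) =
      (n + a) * weightCoeff a n := by
  have h := (binomCoeff_pos ha n).le
  rw [weightCoeff, weightCoeff, binomCoeff_succ, ← Real.sqrt_mul (by
    have : (0 : ℝ) ≤ n := n.cast_nonneg
    apply mul_nonneg <;> linarith)]
  have e := Real.sqrt_sq (show (0 : ℝ) ≤ n + a by positivity)
  refine Eq.trans ?_ (congrArg (· * _) e)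
  rw [← Real.sqrt_mul (by positivity)]
  congr 1
  field_simp
  ring

theorem weightCoeff_mul_laguerreExpr_zero {a : ℝ} (ha : 0 < a) (f : ℕ → ℂ) :
    (weightCoeff a 0 : ℂ) * laguerreExpr (a - 1) f 0 =
      a * (weightCoeff a 0 * f 0) + weightCoeff a 1 * f 1 := by
  have h := congrArg (Complex.ofReal) (sqrt_mul_weightCoeff ha 0)
  push_cast at h
  simp only [laguerreExpr, jacobiExpr, LinearMap.coe_mk, AddHom.coe_mk, if_true]
  push_cast
  linear_combination f 1 * h

theorem weightCoeff_mul_laguerreExpr_succ {a : ℝ} (ha : 0 < a) (f : ℕ → ℂ) (n : ℕ) :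
    (weightCoeff a (n + 1) : ℂ) * laguerreExpr (a - 1) f (n + 1) =
      (n + a) * (weightCoeff a n * f n) + (2 * (n + 1) + a) * (weightCoeff a (n + 1) * f (n + 1))
        + (n + 2) * (weightCoeff a (n + 2) * f (n + 2)) := by
  have h := congrArg (Complex.ofReal) (sqrt_mul_weightCoeff ha (n + 1))
  have h2 := congrArg (Complex.ofReal) (sqrt_mul_weightCoeff_succ ha n)
  push_cast at h h2
  simp only [laguerreExpr, jacobiExpr, LinearMap.coe_mk, AddHom.coe_mk, Nat.add_sub_cancel,
    Nat.add_eq_zero_iff, one_ne_zero, and_false, if_false]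
  push_cast
  linear_combination f (n + 2) * h + f n * h2

/-- On generating functions, a coefficient affine in `n` is a first-order differential operator.
With `D` in the role of `G'`, the three terms of the recurrence contribute `x(xD + aG)`, `2xD + aG`
and `D`. -/
theorem hasSum_weightCoeff_mul_laguerreExpr {a : ℝ} (ha : 0 < a) {f : ℕ → ℂ}
    {x G D : ℂ} (hG : HasSum (fun n => weightCoeff a n * f n * x ^ n) G)
    (hD : HasSum (fun n : ℕ => ((n : ℂ) + 1) * (weightCoeff a (n + 1) * f (n + 1)) * x ^ n) D) :
    HasSum (fun n => weightCoeff a n * laguerreExpr (a - 1) f n * x ^ n)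
      ((1 + x) ^ 2 * D + a * (1 + x) * G) := by
  have h2 : HasSum (fun n : ℕ => (n : ℂ) * (weightCoeff a n * f n) * x ^ n) (x * D) := by
    rw [← hasSum_nat_add_iff' 1]
    simp only [Finset.sum_range_one, Nat.cast_zero, zero_mul, sub_zero]
    have h := hD.mul_left x
    have e : (fun n : ℕ => ((n + 1 : ℕ) : ℂ) * (weightCoeff a (n + 1) * f (n + 1)) * x ^ (n + 1)) =
        fun n : ℕ => x * (((n : ℂ) + 1) * (weightCoeff a (n + 1) * f (n + 1)) * x ^ n) := by
      funext n; push_cast; ring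
    rwa [e]
  have h3 : HasSum (fun n : ℕ => ((n : ℂ) + a) * (weightCoeff a n * f n) * x ^ (n + 1))
      (x * (x * D + a * G)) := by
    have h := (h2.add (hG.mul_left (a : ℂ))).mul_left x
    have e : (fun n : ℕ => ((n : ℂ) + a) * (weightCoeff a n * f n) * x ^ (n + 1)) =
        fun n : ℕ => x * ((n : ℂ) * (weightCoeff a n * f n) * x ^ n +
          a * (weightCoeff a n * f n * x ^ n)) := by
      funext n; ring
    rwa [e]
  have h4 := (hD.add ((h2.mul_left 2).add (hG.mul_left (a : ℂ))))
  rw [← hasSum_nat_add_iff' 1] at h4 ⊢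
  have h5 := h4.add h3
  simp only [Finset.sum_range_one, Nat.cast_zero, pow_zero, mul_one, zero_mul, mul_zero, zero_add,
    one_mul] at h5 ⊢
  rw [weightCoeff_mul_laguerreExpr_zero ha]
  have e : (fun n : ℕ => (weightCoeff a (n + 1) : ℂ) * laguerreExpr (a - 1) f (n + 1) * x ^ (n + 1))
      = fun n : ℕ => (((n + 1 : ℕ) : ℂ) + 1) * (weightCoeff a (n + 1 + 1) * f (n + 1 + 1)) *
        x ^ (n + 1) + (2 * (((n + 1 : ℕ) : ℂ) * (weightCoeff a (n + 1) * f (n + 1)) * x ^ (n + 1)) +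
        a * (weightCoeff a (n + 1) * f (n + 1) * x ^ (n + 1))) +
        ((n : ℂ) + a) * (weightCoeff a n * f n) * x ^ (n + 1) := by
    funext n
    rw [weightCoeff_mul_laguerreExpr_succ ha]
    push_cast
    ring
  rw [e]
  have e2 : (1 + x) ^ 2 * D + a * (1 + x) * G -
      (a * (weightCoeff a 0 * f 0) + weightCoeff a 1 * f 1) =
      D + (2 * (x * D) + a * G) - (weightCoeff a 1 * f 1 + a * (weightCoeff a 0 * f 0)) +
        x * (x * D + a * G) := by ring
  rw [e2]
  exact h5

/-- The pairing of a sequence with the coherent vectors, as an analytic function on the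
half-plane `1 / 2 < re z`. -/
def laguerreTransform (a : ℝ) (f : ℕ → ℂ) (z : ℂ) : ℂ :=
  z ^ (-(a : ℂ)) * ∑' n, weightCoeff a n * f n * (z⁻¹ - 1) ^ n

theorem diskSummable_weightCoeff_mul_laguerreExpr {a : ℝ} (ha : 0 < a) {f : ℕ → ℂ}
    (hf : DiskSummable fun n => weightCoeff a n * f n) :
    DiskSummable fun n => weightCoeff a n * laguerreExpr (a - 1) f n := by
  intro x hx
  obtain ⟨D, -, hD⟩ := hasSum_deriv_of_diskSummable hf hx
  exact (hasSum_weightCoeff_mul_laguerreExpr ha (hf x hx).hasSum hD).summable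

/-- With `x = 1/z - 1` one has `1 + x = 1/z` and `dx/dz = -1/z²`, so `(1+x)² d/dx` becomes `-d/dz`,
and the term `a(1+x)` is absorbed by differentiating the prefactor `z^(-a)`. -/
theorem hasDerivAt_laguerreTransform {a : ℝ} (ha : 0 < a) {f : ℕ → ℂ}
    (hf : DiskSummable fun n => weightCoeff a n * f n) {z : ℂ} (hz : 1 / 2 < z.re) :
    HasDerivAt (laguerreTransform a f) (-laguerreTransform a (laguerreExpr (a - 1) f) z) z := by
  have hz0 := ne_zero_of_half_lt_re hz
  have hx := (norm_inv_sub_one_lt_one_iff hz0).2 hz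
  obtain ⟨D, hD', hD⟩ := hasSum_deriv_of_diskSummable hf hx
  have hJ := (hasSum_weightCoeff_mul_laguerreExpr ha (hf _ hx).hasSum hD).tsum_eq
  have h1 : HasDerivAt (fun z : ℂ => z ^ (-(a : ℂ))) (-(a : ℂ) * z ^ (-(a : ℂ) - 1)) z := by
    have := (hasDerivAt_id z).cpow_const (c := -(a : ℂ)) (Or.inl (by simp; linarith))
    simpa using this
  have h2 : HasDerivAt (fun z : ℂ => z⁻¹ - 1) (-(z ^ 2)⁻¹) z := (hasDerivAt_inv hz0).sub_const 1
  have h3 := h1.mul (HasDerivAt.comp z hD' h2)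
  refine h3.congr_deriv ?_
  rw [laguerreTransform, hJ, Complex.cpow_sub _ _ hz0, Complex.cpow_one]
  simp only [Function.comp]
  field_simp
  ring

/-- The points `1/z - 1` fill the whole unit disk and the weights are nonzero, so this is uniqueness
of power series coefficients. The sequences need not be in `ℓ²`, which matters when the domain of
the generator is identified. -/
theorem laguerreTransform_injective {a : ℝ} (ha : 0 < a) {f g : ℕ → ℂ}
    (hf : DiskSummable fun n => weightCoeff a n * f n)
    (hg : DiskSummable fun n => weightCoeff a n * g n)
    (h : ∀ z : ℂ, 1 / 2 < z.re → laguerreTransform a f z = laguerreTransform a g z) : f = g := by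
  have h0 : (fun n => (weightCoeff a n : ℂ) * f n - weightCoeff a n * g n) = 0 := by
    apply eq_zero_of_forall_tsum_eq_zero
    · intro x hx
      simpa [sub_mul] using (hf x hx).sub (hg x hx)
    · intro x hx
      have hx1 : 1 + x ≠ 0 := by
        intro h0
        have : x = -1 := by linear_combination h0
        simp [this] at hx
      have e : ((1 + x)⁻¹)⁻¹ - 1 = x := by rw [inv_inv]; ring
      have hz : 1 / 2 < ((1 + x)⁻¹).re := by
        rw [← norm_inv_sub_one_lt_one_iff (inv_ne_zero hx1), e]
        exact hx
      have h1 := h _ hz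
      rw [laguerreTransform, laguerreTransform, e] at h1
      have h2 := mul_left_cancel₀ (by
        rw [Ne, Complex.cpow_eq_zero_iff]
        exact fun h => inv_ne_zero hx1 h.1) h1
      simp only [sub_mul]
      rw [(hf x hx).tsum_sub (hg x hx), h2, sub_self]
  funext n
  have h1 := congrFun h0 n
  simp only [Pi.zero_apply, ← mul_sub] at h1
  have h2 : (weightCoeff a n : ℂ) ≠ 0 := by exact_mod_cast (weightCoeff_pos ha n).ne'
  exact sub_eq_zero.1 ((mul_eq_zero.1 h1).resolve_left h2)

theorem diskSummable_weightCoeff_mul_of_bounded {a : ℝ} (ha : 0 < a) {f : ℕ → ℂ} {C : ℝ}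
    (hf : ∀ n, ‖f n‖ ≤ C) : DiskSummable fun n => weightCoeff a n * f n := by
  intro x hx
  have h1 := ((hasSum_binomCoeff_real a (norm_nonneg x) hx).summable.add
    (summable_geometric_of_lt_one (norm_nonneg x) hx)).mul_left C
  refine Summable.of_norm_bounded h1 fun n => ?_
  have hw : weightCoeff a n ≤ binomCoeff a n + 1 := by
    rw [← weightCoeff_sq ha]
    nlinarith [sq_nonneg (weightCoeff a n - 1), weightCoeff_pos ha n]
  have hC := (norm_nonneg (f n)).trans (hf n)
  rw [norm_mul, norm_mul, norm_pow, Complex.norm_real, Real.norm_of_nonneg (weightCoeff_pos ha n).le]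
  calc weightCoeff a n * ‖f n‖ * ‖x‖ ^ n ≤ (binomCoeff a n + 1) * C * ‖x‖ ^ n := by
        have := (weightCoeff_pos ha n).le
        gcongr
        · linarith
        · exact hf n
    _ = C * (binomCoeff a n * ‖x‖ ^ n + ‖x‖ ^ n) := by ring

end LaguerreTransform

/-! ### Coherent vectors: totality and Gram kernel. -/

section Coherent

/-- The half-plane `1 / 2 < re w`, which parametrizes the coherent vectors. -/
abbrev HalfPlane : Type := {w : ℂ // 1 / 2 < w.re}

namespace HalfPlane

/-- Vertical translation of the half-plane. -/
def shift (w : HalfPlane) (t : ℝ) : HalfPlane :=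
  ⟨w + t * Complex.I, by simpa using w.2⟩

@[simp] theorem coe_shift (w : HalfPlane) (t : ℝ) : (w.shift t : ℂ) = w + t * Complex.I := rfl

theorem shift_shift (w : HalfPlane) (s t : ℝ) : (w.shift s).shift t = w.shift (s + t) :=
  Subtype.ext (by simp; ring)

theorem shift_zero (w : HalfPlane) : w.shift 0 = w := Subtype.ext (by simp)

theorem half_lt_re_conj (w : HalfPlane) : 1 / 2 < (conj (w : ℂ)).re := by simpa using w.2

theorem arg_ne_pi (w : HalfPlane) : (w : ℂ).arg ≠ Real.pi := by
  have h := w.2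
  have := (abs_lt.1 (Complex.abs_arg_lt_pi_div_two_iff.2
    (Or.inl (by linarith : 0 < (w : ℂ).re)))).2
  have := Real.pi_pos
  linarith

end HalfPlane

/-- The coordinates of the coherent vectors. -/
def coherentSeq (a : ℝ) (w : ℂ) (n : ℕ) : ℂ :=
  w ^ (-(a : ℂ)) * (weightCoeff a n * (w⁻¹ - 1) ^ n)

theorem memℓp_coherentSeq {a : ℝ} (ha : 0 < a) (w : HalfPlane) : Memℓp (coherentSeq a w) 2 := by
  have hx := (norm_inv_sub_one_lt_one_iff (ne_zero_of_half_lt_re w.2)).2 w.2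
  rw [memℓp_gen_iff (by norm_num)]
  have h := (hasSum_binomCoeff_real a (r := ‖(w : ℂ)⁻¹ - 1‖ ^ 2) (by positivity)
    (by nlinarith [norm_nonneg ((w : ℂ)⁻¹ - 1)])).summable.mul_left (‖(w : ℂ) ^ (-(a : ℂ))‖ ^ 2)
  refine h.congr fun n => ?_
  rw [coherentSeq, norm_mul, norm_mul, norm_pow, Complex.norm_real,
    Real.norm_of_nonneg (weightCoeff_pos ha n).le, ← weightCoeff_sq ha]
  simp only [ENNReal.toReal_ofNat, Real.rpow_ofNat]
  ring

/-- The coherent vectors of the Laguerre operator, normalized so that the unitary group acts on them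
by translation of the parameter. -/
def coherent {a : ℝ} (ha : 0 < a) (w : HalfPlane) : EllTwo := ⟨coherentSeq a w, memℓp_coherentSeq ha w⟩

theorem conj_coherentSeq (a : ℝ) (w : HalfPlane) (n : ℕ) :
    conj (coherentSeq a w n) = coherentSeq a (conj (w : ℂ)) n := by
  simp only [coherentSeq, map_mul, map_pow, map_sub, map_inv₀, map_one, Complex.conj_ofReal]
  rw [Complex.conj_cpow _ _ w.arg_ne_pi]
  simp

variable {a : ℝ} (ha : 0 < a)

theorem inner_coherent (w : HalfPlane) (x : EllTwo) :
    inner ℂ (coherent ha w) x = laguerreTransform a x (conj (w : ℂ)) := by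
  rw [lp.inner_eq_tsum, laguerreTransform, ← tsum_mul_left]
  refine tsum_congr fun n => ?_
  change inner ℂ (coherentSeq a w n) (x n) = _
  rw [RCLike.inner_apply, conj_coherentSeq, coherentSeq]
  ring

theorem diskSummable_weightCoeff_mul_coe {a : ℝ} (ha : 0 < a) (x : EllTwo) :
    DiskSummable fun n => weightCoeff a n * x n :=
  diskSummable_weightCoeff_mul_of_bounded ha fun n => lp.norm_apply_le_norm two_ne_zero x n

theorem dense_span_coherent :
    Dense (Submodule.span ℂ (Set.range (coherent ha)) : Set EllTwo) := by
  refine dense_span_of_forall_inner_eq_zero _ fun x hx => ?_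
  have h : (x : ℕ → ℂ) = ((0 : EllTwo) : ℕ → ℂ) := by
    refine laguerreTransform_injective ha (diskSummable_weightCoeff_mul_coe ha x)
      (diskSummable_weightCoeff_mul_coe ha 0) fun z hz => ?_
    have h1 := inner_coherent ha ⟨conj z, by simpa using hz⟩ x
    have h2 := inner_coherent ha ⟨conj z, by simpa using hz⟩ 0
    rw [hx] at h1
    simp only [Complex.conj_conj, inner_zero_right] at h1 h2
    rw [← h1, ← h2]
  exact lp.ext h

/-- The inner product of coherent vectors of different weights, as a power series. -/
theorem inner_coherent_coherent_eq_tsum {b : ℝ} (hb : 0 < b) (w z : HalfPlane) :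
    inner ℂ (coherent hb w) (coherent ha z) =
      conj (w : ℂ) ^ (-(b : ℂ)) * (z : ℂ) ^ (-(a : ℂ)) *
        ∑' n, ((weightCoeff b n * weightCoeff a n : ℝ) : ℂ) *
          (((conj (w : ℂ))⁻¹ - 1) * ((z : ℂ)⁻¹ - 1)) ^ n := by
  rw [inner_coherent, laguerreTransform, mul_assoc, ← tsum_mul_left (a := (z : ℂ) ^ (-(a : ℂ)))]
  congr 1
  refine tsum_congr fun n => ?_
  change _ * coherentSeq a z n * _ = _
  rw [coherentSeq, mul_pow]
  push_cast
  ring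

/-- For equal weights the coefficients are exactly binomial, and the prefactors cancel the powers
produced by `one_sub_mul_inv_sub_one_cpow`. -/
theorem inner_coherent_coherent (w z : HalfPlane) :
    inner ℂ (coherent ha w) (coherent ha z) = (conj (w : ℂ) + z - 1) ^ (-(a : ℂ)) := by
  have h := (hasSum_binomCoeff a (norm_mul_inv_sub_one_lt_one w.half_lt_re_conj z.2)).tsum_eq
  rw [one_sub_mul_inv_sub_one_cpow w.half_lt_re_conj z.2] at h
  have hw0 : conj (w : ℂ) ≠ 0 := ne_zero_of_half_lt_re w.half_lt_re_conj
  have hz0 := ne_zero_of_half_lt_re z.2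
  rw [inner_coherent_coherent_eq_tsum ha ha]
  simp only [← pow_two, weightCoeff_sq ha]
  rw [h, Complex.cpow_neg (conj (w : ℂ)), Complex.cpow_neg (z : ℂ)]
  have h1 : conj (w : ℂ) ^ (a : ℂ) ≠ 0 := by simp [Complex.cpow_eq_zero_iff, hw0]
  have h2 : (z : ℂ) ^ (a : ℂ) ≠ 0 := by simp [Complex.cpow_eq_zero_iff, hz0]
  field_simp

end Coherent

/-! ### The unitary group of the Laguerre operator as translation of coherent vectors. -/

section LaguerreGroup

variable {a : ℝ} (ha : 0 < a)

/-- The domain is maximal, so membership in the graph is a mere identity of sequences; `g ∈ ℓ²`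
already puts `f` in the domain. -/
theorem mem_graph_laguerreOperator_iff {p : ℝ} {f g : EllTwo} :
    (f, g) ∈ (laguerreOperator p).graph ↔ laguerreExpr p f = g := by
  rw [LinearPMap.mem_graph_iff]
  constructor
  · rintro ⟨y, hy, hg⟩
    obtain rfl : (y : EllTwo) = f := hy
    obtain rfl : laguerreOperator p y = g := hg
    rfl
  · intro h
    have hf : f ∈ (laguerreOperator p).domain := by
      change Memℓp (laguerreExpr p f) 2
      rw [h]
      exact lp.memℓp g
    exact ⟨⟨f, hf⟩, rfl, lp.ext h⟩

theorem dense_span_coherent_shift (t : ℝ) :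
    Dense (Submodule.span ℂ (Set.range fun w : HalfPlane => coherent ha (w.shift t)) :
      Set EllTwo) := by
  have h : Set.range (fun w : HalfPlane => coherent ha (w.shift t)) = Set.range (coherent ha) := by
    refine Function.Surjective.range_comp (f := fun w : HalfPlane => w.shift t) (fun w => ?_)
      (coherent ha)
    exact ⟨w.shift (-t), by simp only [HalfPlane.shift_shift, neg_add_cancel, HalfPlane.shift_zero]⟩
  rw [h]
  exact dense_span_coherent ha

/-- The Gram kernel depends only on `conj w + z`, which is unchanged when both parameters move by
`it`. -/
theorem exists_laguerreTranslation (t : ℝ) :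
    ∃ T : EllTwo ≃ₗᵢ[ℂ] EllTwo, ∀ w, T (coherent ha w) = coherent ha (w.shift t) := by
  refine exists_linearIsometryEquiv_of_inner_eq _ _ (dense_span_coherent ha)
    (dense_span_coherent_shift ha t) fun w z => ?_
  rw [inner_coherent_coherent, inner_coherent_coherent]
  congr 1
  simp
  ring

/-- The unitary operator that translates the coherent vectors by `t`. -/
def laguerreTranslation (t : ℝ) : EllTwo ≃ₗᵢ[ℂ] EllTwo := (exists_laguerreTranslation ha t).choose

theorem laguerreTranslation_coherent (t : ℝ) (w : HalfPlane) :
    laguerreTranslation ha t (coherent ha w) = coherent ha (w.shift t) :=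
  (exists_laguerreTranslation ha t).choose_spec w

/-- The group of translations of the coherent vectors, as bounded operators. -/
def laguerreGroup (t : ℝ) : EllTwo →L[ℂ] EllTwo :=
  (laguerreTranslation ha t).toLinearIsometry.toContinuousLinearMap

theorem laguerreGroup_coherent (t : ℝ) (w : HalfPlane) :
    laguerreGroup ha t (coherent ha w) = coherent ha (w.shift t) :=
  laguerreTranslation_coherent ha t w

theorem laguerreGroup_mem_unitary (t : ℝ) :
    laguerreGroup ha t ∈ unitary (EllTwo →L[ℂ] EllTwo) :=
  (Unitary.linearIsometryEquiv.symm (laguerreTranslation ha t)).2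

theorem laguerreGroup_add (s t : ℝ) :
    laguerreGroup ha (s + t) = laguerreGroup ha s ∘L laguerreGroup ha t := by
  refine ContinuousLinearMap.ext_on (dense_span_coherent ha) ?_
  rintro _ ⟨w, rfl⟩
  rw [ContinuousLinearMap.comp_apply, laguerreGroup_coherent, laguerreGroup_coherent,
    laguerreGroup_coherent, HalfPlane.shift_shift, add_comm]

theorem inner_laguerreGroup (t : ℝ) (x y : EllTwo) :
    inner ℂ (laguerreGroup ha t x) (laguerreGroup ha t y) = inner ℂ x y :=
  inner_apply_apply_of_mem_unitary (laguerreGroup_mem_unitary ha t) x y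

theorem inner_coherent_laguerreGroup (t : ℝ) (w : HalfPlane) (x : EllTwo) :
    inner ℂ (coherent ha w) (laguerreGroup ha t x) =
      laguerreTransform a x (conj (w : ℂ) + t * Complex.I) := by
  have h : coherent ha w = laguerreGroup ha t (coherent ha (w.shift (-t))) := by
    rw [laguerreGroup_coherent, HalfPlane.shift_shift, neg_add_cancel, HalfPlane.shift_zero]
  rw [h, inner_laguerreGroup, inner_coherent]
  congr 1
  simp

theorem continuous_laguerreGroup (x : EllTwo) : Continuous fun t => laguerreGroup ha t x := by
  rw [continuous_iff_continuousAt]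
  intro t
  have hn := fun t x => norm_apply_of_mem_unitary (laguerreGroup_mem_unitary ha t) x
  refine tendsto_of_tendsto_inner (fun s => laguerreGroup ha s) (laguerreGroup ha t) hn (hn t)
    (dense_span_coherent ha) (dense_span_coherent ha) (fun w z => ?_) x
  simp only [laguerreGroup_coherent, inner_coherent_coherent]
  have hc : ContinuousAt (fun s : ℝ => conj ((w.shift s : HalfPlane) : ℂ) + (z : ℂ) - 1) t := by
    simp only [HalfPlane.coe_shift]
    fun_prop
  refine (hc.cpow continuousAt_const (Or.inl ?_)).tendsto
  have := w.2
  have := z.2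
  simp
  linarith

theorem hasDerivAt_inner_coherent_laguerreGroup (w : HalfPlane) (x : EllTwo) (t : ℝ) :
    HasDerivAt (fun s => inner ℂ (coherent ha w) (laguerreGroup ha s x))
      (-laguerreTransform a (laguerreExpr (a - 1) x) (conj (w : ℂ) + t * Complex.I) * Complex.I)
      t := by
  simp only [inner_coherent_laguerreGroup]
  have hz : 1 / 2 < (conj (w : ℂ) + t * Complex.I).re := by simpa using w.2
  have h1 := hasDerivAt_laguerreTransform ha (diskSummable_weightCoeff_mul_coe ha x) hz
  have h2 : HasDerivAt (fun s : ℝ => conj (w : ℂ) + s * Complex.I) Complex.I t := by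
    simpa using ((hasDerivAt_id t).ofReal_comp.mul_const Complex.I).const_add (conj (w : ℂ))
  exact HasDerivAt.comp t h1 h2

theorem isUnitaryGroupOf_laguerreGroup :
    IsUnitaryGroupOf (laguerreOperator (a - 1)) (laguerreGroup ha) where
  unitary := laguerreGroup_mem_unitary ha
  map_add := laguerreGroup_add ha
  continuous := continuous_laguerreGroup ha
  generator f g := by
    have h0 : laguerreGroup ha 0 g = g := by
      have h : laguerreGroup ha 0 = ContinuousLinearMap.id ℂ EllTwo := by
        refine ContinuousLinearMap.ext_on (dense_span_coherent ha) ?_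
        rintro _ ⟨w, rfl⟩
        rw [laguerreGroup_coherent, HalfPlane.shift_zero]
        rfl
      rw [h]
      rfl
    rw [mem_graph_laguerreOperator_iff]
    constructor
    · intro h
      have hd := hasDerivAt_of_hasDerivAt_inner (dense_span_coherent ha)
        (u := fun t => laguerreGroup ha t f) (v := fun t => -Complex.I • laguerreGroup ha t g)
        ((continuous_laguerreGroup ha g).const_smul (-Complex.I)) (fun w t => ?_) 0
      · simpa only [h0] using hd
      · refine (hasDerivAt_inner_coherent_laguerreGroup ha w f t).congr_deriv ?_
        rw [inner_smul_right, inner_coherent_laguerreGroup, h]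
        ring
    -- Pairing the derivative at `0` with coherent vectors shows that the sequences `J f` and `g`
    -- have the same transform. Injectivity gives `J f = g` before `J f` is known to be
    -- square-summable.
    · intro h
      refine laguerreTransform_injective ha (diskSummable_weightCoeff_mul_laguerreExpr ha
        (diskSummable_weightCoeff_mul_coe ha f)) (diskSummable_weightCoeff_mul_coe ha g)
        fun z hz => ?_
      set w : HalfPlane := ⟨conj z, by simpa using hz⟩ with hw
      have h1 := hasDerivAt_inner_coherent_laguerreGroup ha w f 0
      have h2 := ((innerSL ℂ (coherent ha w)).restrictScalars ℝ).hasFDerivAt.comp_hasDerivAt 0 h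
      have h3 := h1.unique h2
      simp only [ContinuousLinearMap.coe_restrictScalars', innerSL_apply_apply, inner_smul_right,
        inner_coherent, hw, Complex.conj_conj, Complex.ofReal_zero, zero_mul, add_zero] at h3
      exact mul_left_cancel₀ Complex.I_ne_zero (by linear_combination -h3)

theorem isUnitaryGroupOf_unitaryGroup_laguerre {a : ℝ} (ha : 0 < a) :
    IsUnitaryGroupOf (laguerreOperator (a - 1)) (unitaryGroup (laguerreOperator (a - 1))) :=
  (isUnitaryGroupOf_laguerreGroup ha).isUnitaryGroupOf_unitaryGroup

theorem unitaryGroup_laguerreOperator_coherent (t : ℝ) (w : HalfPlane) :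
    unitaryGroup (laguerreOperator (a - 1)) t (coherent ha w) = coherent ha (w.shift t) := by
  rw [(isUnitaryGroupOf_unitaryGroup_laguerre ha).unique (isUnitaryGroupOf_laguerreGroup ha),
    laguerreGroup_coherent]

end LaguerreGroup

/-! ### Euler's Gamma integral with a complex parameter. -/

section GammaIntegral

open MeasureTheory Set

theorem norm_cexp_neg_mul_ofReal (r : ℂ) (x : ℝ) :
    ‖Complex.exp (-(r * x))‖ = Real.exp (-(r.re * x)) := by
  rw [Complex.norm_exp]; simp

theorem integrableOn_rpow_mul_exp_neg_mul {s b : ℝ} (hs : -1 < s) (hb : 0 < b) :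
    IntegrableOn (fun x : ℝ => x ^ s * Real.exp (-(b * x))) (Ioi 0) := by
  simpa using integrableOn_rpow_mul_exp_neg_mul_rpow hs one_pos hb

theorem integrableOn_rpow_mul_cexp_neg_mul {s : ℝ} {r : ℂ} (hs : -1 < s) (hr : 0 < r.re) :
    IntegrableOn (fun x : ℝ => ((x ^ s : ℝ) : ℂ) * Complex.exp (-(r * x))) (Ioi 0) := by
  refine (integrableOn_rpow_mul_exp_neg_mul hs hr).mono' ?_ ?_
  · refine AEStronglyMeasurable.mul ?_ (by fun_prop)
    exact (by fun_prop : Measurable fun x : ℝ => ((x ^ s : ℝ) : ℂ)).aestronglyMeasurable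
  · filter_upwards [self_mem_ae_restrict measurableSet_Ioi] with x hx
    rw [norm_mul, norm_cexp_neg_mul_ofReal, Complex.norm_real,
      Real.norm_of_nonneg (Real.rpow_nonneg (le_of_lt hx) _)]

theorem differentiableAt_integral_rpow_mul_cexp_neg_mul {s : ℝ} {r : ℂ} (hs : -1 < s)
    (hr : 0 < r.re) : DifferentiableAt ℂ
      (fun r : ℂ => ∫ x in Ioi (0 : ℝ), ((x ^ s : ℝ) : ℂ) * Complex.exp (-(r * x))) r := by
  have hm : ∀ (s : ℝ) (r : ℂ), AEStronglyMeasurable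
      (fun x : ℝ => ((x ^ s : ℝ) : ℂ) * Complex.exp (-(r * x))) (volume.restrict (Ioi 0)) := by
    intro s r
    refine AEStronglyMeasurable.mul ?_ (by fun_prop)
    exact (by fun_prop : Measurable fun x : ℝ => ((x ^ s : ℝ) : ℂ)).aestronglyMeasurable
  have hopen : {z : ℂ | r.re / 2 < z.re} ∈ 𝓝 r :=
    (isOpen_lt continuous_const Complex.continuous_re).mem_nhds (by simpa using hr)
  refine (hasDerivAt_integral_of_dominated_loc_of_deriv_le (𝕜 := ℂ)
    (F := fun (r : ℂ) (x : ℝ) => ((x ^ s : ℝ) : ℂ) * Complex.exp (-(r * x)))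
    (F' := fun (r : ℂ) (x : ℝ) => -(x * (((x ^ s : ℝ) : ℂ) * Complex.exp (-(r * x)))))
    (bound := fun x => x ^ (s + 1) * Real.exp (-(r.re / 2 * x))) hopen
    (Eventually.of_forall fun z => hm s z) (integrableOn_rpow_mul_cexp_neg_mul hs hr)
    ?_ ?_ (integrableOn_rpow_mul_exp_neg_mul (by linarith) (by linarith)) ?_).2.differentiableAt
  · exact (AEStronglyMeasurable.mul (by fun_prop) (hm s r)).neg
  · filter_upwards [self_mem_ae_restrict measurableSet_Ioi] with x hx z hz
    have hx' : 0 < x := hx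
    rw [norm_neg, norm_mul, norm_mul, norm_cexp_neg_mul_ofReal, Complex.norm_real,
      Complex.norm_real, Real.norm_of_nonneg (Real.rpow_nonneg hx'.le _),
      Real.norm_of_nonneg hx'.le, Real.rpow_add_one hx'.ne', mul_comm (x ^ s) x, mul_assoc]
    have : r.re / 2 * x ≤ z.re * x := mul_le_mul_of_nonneg_right (le_of_lt hz) hx'.le
    have h2 := Real.rpow_nonneg hx'.le s
    gcongr
  · refine Eventually.of_forall fun x z _ => ?_
    have h1 : HasDerivAt (fun z : ℂ => -(z * x)) (-(x : ℂ)) z := by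
      have h := ((hasDerivAt_id z).mul_const (x : ℂ)).neg
      rw [one_mul] at h
      exact h
    refine (h1.cexp.const_mul ((x ^ s : ℝ) : ℂ)).congr_deriv ?_
    ring

/-- Euler's integral for the Gamma function, with a complex dilation parameter. -/
theorem integral_rpow_mul_cexp_neg_mul {g : ℝ} {r : ℂ} (hg : 0 < g) (hr : 0 < r.re) :
    ∫ x in Ioi (0 : ℝ), ((x ^ (g - 1) : ℝ) : ℂ) * Complex.exp (-(r * x)) =
      Real.Gamma g * r ^ (-(g : ℂ)) := by
  have hU : IsOpen {z : ℂ | 0 < z.re} := isOpen_lt continuous_const Complex.continuous_re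
  have h1 : AnalyticOnNhd ℂ (fun r : ℂ =>
      ∫ x in Ioi (0 : ℝ), ((x ^ (g - 1) : ℝ) : ℂ) * Complex.exp (-(r * x))) {z | 0 < z.re} :=
    DifferentiableOn.analyticOnNhd (fun z hz =>
      (differentiableAt_integral_rpow_mul_cexp_neg_mul (by linarith)
        hz).differentiableWithinAt) hU
  have h2 : AnalyticOnNhd ℂ (fun r : ℂ => Real.Gamma g * r ^ (-(g : ℂ))) {z | 0 < z.re} := by
    refine DifferentiableOn.analyticOnNhd (fun z hz => ?_) hU
    refine DifferentiableAt.differentiableWithinAt ?_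
    refine DifferentiableAt.const_mul ?_ _
    exact differentiableAt_id.cpow_const (Or.inl hz)
  -- Identity theorem on the right half-plane: both sides agree at positive real parameters, which
  -- accumulate at `1`.
  refine h1.eqOn_of_preconnected_of_frequently_eq h2 (convex_halfSpace_re_gt 0).isPreconnected
    (z₀ := 1) (by simp) ?_ hr
  have ht : Tendsto (fun t : ℝ => (t : ℂ)) (𝓝[≠] 1) (𝓝[≠] 1) := by
    refine tendsto_nhdsWithin_iff.2 ⟨?_, ?_⟩
    · exact (Complex.continuous_ofReal.tendsto' 1 1 (by simp)).mono_left nhdsWithin_le_nhds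
    · filter_upwards [self_mem_nhdsWithin] with t ht
      simpa using ht
  refine ht.frequently (Eventually.frequently ?_)
  filter_upwards [nhdsWithin_le_nhds (lt_mem_nhds (zero_lt_one (α := ℝ)))] with t ht
  have h3 := congrArg Complex.ofReal (Real.integral_rpow_mul_exp_neg_mul_Ioi hg ht)
  rw [← integral_complex_ofReal, one_div, Real.inv_rpow ht.le, ← Real.rpow_neg ht.le] at h3
  push_cast [Complex.ofReal_cpow ht.le] at h3
  rw [mul_comm (Real.Gamma g : ℂ), ← h3]

end GammaIntegral

/-! ### Injectivity of the Fourier transform on integrable functions. -/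

section FourierUniqueness

open MeasureTheory Set

/-- An integrable function whose Fourier transform vanishes is zero almost everywhere. -/
theorem ae_eq_zero_of_forall_integral_cexp_mul_eq_zero {g : ℝ → ℂ} (hg : Integrable g)
    (h : ∀ t : ℝ, ∫ x : ℝ, Complex.exp (t * x * Complex.I) * g x = 0) : ∀ᵐ x, g x = 0 := by
  have hF : ∀ ξ, FourierTransform.fourier g ξ = 0 := by
    intro ξ
    rw [Real.fourier_real_eq_integral_exp_smul, ← h (-2 * Real.pi * ξ)]
    refine integral_congr_ae (Eventually.of_forall fun x => ?_)
    simp only [smul_eq_mul]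
    congr 2
    push_cast
    ring
  -- A test function `φ` is the Fourier transform of a Schwartz function `χ`; moving the transform
  -- from `χ` to `g` makes the integral of `φ g` vanish.
  refine ae_eq_zero_of_integral_contDiff_smul_eq_zero hg.locallyIntegrable fun φ hφ hc => ?_
  have hg₁ : HasCompactSupport (Complex.ofRealCLM ∘ φ) := hc.comp_left rfl
  have hg₂ : ContDiff ℝ (⊤ : ℕ∞) (Complex.ofRealCLM ∘ φ) := Complex.ofRealCLM.contDiff.comp hφ
  set ψ : SchwartzMap ℝ ℂ := hg₁.toSchwartzMap hg₂ with hψ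
  set χ : SchwartzMap ℝ ℂ := FourierTransformInv.fourierInv ψ with hχ
  have h1 : FourierTransform.fourier (χ : ℝ → ℂ) = ψ := by
    rw [← SchwartzMap.fourier_coe, hχ, FourierTransform.fourier_fourierInv_eq]
  have h2 : ∫ ξ, FourierTransform.fourier (χ : ℝ → ℂ) ξ • g ξ =
      ∫ x, (χ x) • FourierTransform.fourier g x := by
    simpa using! VectorFourier.integral_fourierIntegral_smul_eq_flip (L := innerₗ ℝ)
      (μ := volume) (ν := volume) Real.continuous_fourierChar continuous_inner χ.integrable hg
  simp only [hF, smul_zero, integral_zero, h1] at h2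
  rw [← h2]
  refine integral_congr_ae (Eventually.of_forall fun x => ?_)
  simp [hψ]

end FourierUniqueness

/-! ### Spectral representation in `L²(0, ∞)`. -/

section LaguerreFunctions

open MeasureTheory Set

/-- The Hilbert space `L²(0, ∞)`. -/
abbrev HalfLineL2 : Type := Lp ℂ 2 (volume.restrict (Ioi (0 : ℝ)))

/-- The spectral representatives of the coherent vectors. -/
def spectralFun (a : ℝ) (w : ℂ) (x : ℝ) : ℂ :=
  ((((Real.sqrt (Real.Gamma a))⁻¹ : ℝ) * (x ^ ((a - 1) / 2) : ℝ) : ℝ) : ℂ) *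
    Complex.exp (-((w - 1 / 2) * x))

theorem aestronglyMeasurable_spectralFun (a : ℝ) (w : ℂ) (μ : Measure ℝ) :
    AEStronglyMeasurable (spectralFun a w) μ := by
  have : Measurable (spectralFun a w) := by
    unfold spectralFun
    fun_prop
  exact this.aestronglyMeasurable

theorem conj_spectralFun_mul_spectralFun {a b : ℝ} {w z : ℂ} {x : ℝ} (hx : 0 < x) :
    conj (spectralFun b w x) * spectralFun a z x =
      (((Real.sqrt (Real.Gamma b) * Real.sqrt (Real.Gamma a))⁻¹ : ℝ) : ℂ) *
        (((x ^ ((a + b) / 2 - 1) : ℝ) : ℂ) * Complex.exp (-((conj w + z - 1) * x))) := by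
  have h1 : x ^ ((a + b) / 2 - 1) = x ^ ((b - 1) / 2) * x ^ ((a - 1) / 2) := by
    rw [← Real.rpow_add hx]; congr 1; ring
  have h2 : Complex.exp (-((conj w + z - 1) * x)) =
      Complex.exp (-((conj w - 1 / 2) * x)) * Complex.exp (-((z - 1 / 2) * x)) := by
    rw [← Complex.exp_add]; congr 1; ring
  have h3 : conj (2 : ℂ) = 2 := Complex.conj_ofNat 2
  rw [spectralFun, spectralFun, h1, h2, map_mul, Complex.conj_ofReal, ← Complex.exp_conj]
  simp only [map_neg, map_mul, map_sub, map_div₀, map_one, Complex.conj_ofReal, h3]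
  push_cast
  ring

theorem norm_spectralFun_sq {a : ℝ} {w : ℂ} {x : ℝ} (hx : 0 < x) :
    ‖spectralFun a w x‖ ^ 2 = (Real.sqrt (Real.Gamma a) * Real.sqrt (Real.Gamma a))⁻¹ *
      (x ^ (a - 1) * Real.exp (-((2 * w.re - 1) * x))) := by
  have h1 : x ^ (a - 1) = x ^ ((a - 1) / 2) * x ^ ((a - 1) / 2) := by
    rw [← Real.rpow_add hx]; congr 1; ring
  have h2 : Real.exp (-((2 * w.re - 1) * x)) =
      Real.exp (-((w.re - 1 / 2) * x)) * Real.exp (-((w.re - 1 / 2) * x)) := by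
    rw [← Real.exp_add]; congr 1; ring
  rw [spectralFun, norm_mul, norm_cexp_neg_mul_ofReal, Complex.norm_real, h1, h2]
  have h3 : (w - 1 / 2).re = w.re - 1 / 2 := by simp
  rw [h3, mul_pow, Real.norm_eq_abs, sq_abs]
  rw [mul_inv]
  ring

theorem memLp_spectralFun {a : ℝ} (ha : 0 < a) (w : HalfPlane) :
    MemLp (spectralFun a w) 2 (volume.restrict (Ioi 0)) := by
  rw [memLp_two_iff_integrable_sq_norm (aestronglyMeasurable_spectralFun a w _)]
  have h := w.2
  have := (integrableOn_rpow_mul_exp_neg_mul (s := a - 1) (b := 2 * (w : ℂ).re - 1)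
    (by linarith) (by linarith)).const_mul (Real.sqrt (Real.Gamma a) * Real.sqrt (Real.Gamma a))⁻¹
  refine this.congr ?_
  filter_upwards [self_mem_ae_restrict measurableSet_Ioi] with x hx
  rw [norm_spectralFun_sq hx]

/-- The spectral representatives of the coherent vectors, as vectors of `L²(0, ∞)`. -/
def spectralVec {a : ℝ} (ha : 0 < a) (w : HalfPlane) : HalfLineL2 := (memLp_spectralFun ha w).toLp

theorem inner_spectralVec {a b : ℝ} (ha : 0 < a) (hb : 0 < b) (w z : HalfPlane) :
    inner ℂ (spectralVec hb w) (spectralVec ha z) =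
      ((Real.Gamma ((a + b) / 2) / (Real.sqrt (Real.Gamma b) * Real.sqrt (Real.Gamma a)) : ℝ) : ℂ) *
        (conj (w : ℂ) + z - 1) ^ (-(((a + b) / 2 : ℝ) : ℂ)) := by
  rw [L2.inner_def]
  have hr : 0 < (conj (w : ℂ) + z - 1).re := by
    have := w.2
    have := z.2
    simp
    linarith
  have h1 : ∫ x in Ioi (0 : ℝ), inner ℂ (spectralVec hb w x) (spectralVec ha z x) =
      ∫ x in Ioi (0 : ℝ), (((Real.sqrt (Real.Gamma b) * Real.sqrt (Real.Gamma a))⁻¹ : ℝ) : ℂ) *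
        (((x ^ ((a + b) / 2 - 1) : ℝ) : ℂ) * Complex.exp (-((conj (w : ℂ) + z - 1) * x))) := by
    refine integral_congr_ae ?_
    filter_upwards [self_mem_ae_restrict measurableSet_Ioi, (memLp_spectralFun hb w).coeFn_toLp,
      (memLp_spectralFun ha z).coeFn_toLp] with x hx h2 h3
    rw [spectralVec, spectralVec, h2, h3, RCLike.inner_apply, mul_comm]
    exact conj_spectralFun_mul_spectralFun hx
  rw [h1, integral_const_mul, integral_rpow_mul_cexp_neg_mul (by linarith) hr]
  push_cast
  ring

theorem spectralFun_ne_zero {a : ℝ} (ha : 0 < a) (w : ℂ) {x : ℝ} (hx : 0 < x) :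
    spectralFun a w x ≠ 0 := by
  refine mul_ne_zero ?_ (Complex.exp_ne_zero _)
  have h1 := Real.sqrt_pos.2 (Real.Gamma_pos_of_pos ha)
  have h2 := Real.rpow_pos_of_pos hx ((a - 1) / 2)
  exact_mod_cast (mul_pos (inv_pos.2 h1) h2).ne'

theorem conj_spectralFun_shift (a : ℝ) (w : HalfPlane) (t x : ℝ) :
    conj (spectralFun a (w.shift t) x) =
      Complex.exp (t * x * Complex.I) * conj (spectralFun a w x) := by
  rw [spectralFun, spectralFun, map_mul, map_mul, Complex.conj_ofReal, ← Complex.exp_conj,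
    ← Complex.exp_conj, mul_left_comm, ← Complex.exp_add]
  have h3 : conj (2 : ℂ) = 2 := Complex.conj_ofNat 2
  congr 2
  simp only [HalfPlane.coe_shift, map_neg, map_mul, map_sub, map_add, map_div₀, map_one,
    Complex.conj_ofReal, Complex.conj_I, h3]
  ring

/-- Shifting the parameter by `t` multiplies the conjugate function by `e^{itx}`. Orthogonality to
the shifts of the single vector at `w = 1` thus kills a Fourier transform, and the function at `w =
1` has no zeros on the half-line. -/
theorem dense_span_spectralVec {a : ℝ} (ha : 0 < a) :
    Dense (Submodule.span ℂ (Set.range (spectralVec ha)) : Set HalfLineL2) := by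
  refine dense_span_of_forall_inner_eq_zero _ fun h hh => ?_
  let w : HalfPlane := ⟨1, by norm_num⟩
  have hi : ∀ v : HalfPlane, (fun x => inner ℂ (spectralVec ha v x) (h x))
      =ᵐ[volume.restrict (Ioi 0)] fun x => conj (spectralFun a v x) * h x := by
    intro v
    filter_upwards [(memLp_spectralFun ha v).coeFn_toLp] with x hx
    rw [spectralVec, hx, RCLike.inner_apply, mul_comm]
  have hint : Integrable ((Ioi (0 : ℝ)).indicator fun x => conj (spectralFun a w x) * h x) := by
    rw [integrable_indicator_iff measurableSet_Ioi]
    exact (L2.integrable_inner (𝕜 := ℂ) (spectralVec ha w) h).congr (hi w)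
  have h0 := ae_eq_zero_of_forall_integral_cexp_mul_eq_zero hint fun t => ?_
  · rw [Lp.eq_zero_iff_ae_eq_zero]
    filter_upwards [self_mem_ae_restrict measurableSet_Ioi, ae_restrict_of_ae h0] with x hx hx0
    rw [indicator_of_mem hx] at hx0
    refine (mul_eq_zero.1 hx0).resolve_left ?_
    simpa using spectralFun_ne_zero ha w hx
  · have h1 := hh (w.shift t)
    rw [L2.inner_def, integral_congr_ae (hi _)] at h1
    rw [← h1, ← integral_indicator measurableSet_Ioi]
    refine integral_congr_ae (Eventually.of_forall fun x => ?_)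
    by_cases hx : x ∈ Ioi (0 : ℝ)
    · simp only [indicator_of_mem hx, conj_spectralFun_shift]
      ring
    · simp only [indicator_of_notMem hx, mul_zero]

/-- The spectral representation of the Laguerre operator. -/
theorem exists_spectralTransform {a : ℝ} (ha : 0 < a) :
    ∃ T : EllTwo ≃ₗᵢ[ℂ] HalfLineL2, ∀ w, T (coherent ha w) = spectralVec ha w := by
  refine exists_linearIsometryEquiv_of_inner_eq _ _ (dense_span_coherent ha)
    (dense_span_spectralVec ha) fun w z => ?_
  rw [inner_coherent_coherent, inner_spectralVec, add_self_div_two,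
    Real.mul_self_sqrt (Real.Gamma_pos_of_pos ha).le, div_self (Real.Gamma_pos_of_pos ha).ne']
  simp

/-- The unitary operator that matches the spectral representations of two Laguerre operators. -/
theorem exists_spectralIntertwiner {a b : ℝ} (ha : 0 < a) (hb : 0 < b) :
    ∃ V : EllTwo ≃ₗᵢ[ℂ] EllTwo, ∀ w z, inner ℂ (coherent hb w) (V (coherent ha z)) =
      ((Real.Gamma ((a + b) / 2) / (Real.sqrt (Real.Gamma b) * Real.sqrt (Real.Gamma a)) : ℝ) : ℂ) *
        (conj (w : ℂ) + z - 1) ^ (-(((a + b) / 2 : ℝ) : ℂ)) := by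
  obtain ⟨S, hS⟩ := exists_spectralTransform ha
  obtain ⟨T, hT⟩ := exists_spectralTransform hb
  refine ⟨S.trans T.symm, fun w z => ?_⟩
  rw [← inner_spectralVec ha hb, ← hS, ← hT, ← T.inner_map_map]
  simp

end LaguerreFunctions

/-! ### Coefficient asymptotics and Abel's theorem in a Stolz angle. -/

section AbelianTheorem

theorem gammaSeq_mul_binomCoeff_succ {s : ℝ} (hs : 0 < s) (n : ℕ) :
    Real.GammaSeq s n * binomCoeff s (n + 1) = (n : ℝ) ^ s / (n + 1) := by
  have h1 : ∏ j ∈ Finset.range (n + 1), (s + (j : ℝ)) ≠ 0 :=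
    (Finset.prod_pos fun j _ => by positivity).ne'
  have h2 : ∏ j ∈ Finset.range (n + 1), ((j : ℝ) + 1) = (n + 1) * (n.factorial : ℝ) := by
    rw [← Finset.prod_range_add_one_eq_factorial, Finset.prod_range_succ]
    push_cast
    ring
  have h3 : (n.factorial : ℝ) ≠ 0 := by positivity
  rw [Real.GammaSeq, binomCoeff, Finset.prod_div_distrib, h2]
  field_simp

/-- By Euler's limit formula `binomCoeff s (n + 1)` is `n^s / (n + 1)` divided by a sequence tending
to `Γ(s)`. The exponent `(a + b) / 2` is the one for which the powers of `n` cancel. -/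
theorem tendsto_weightCoeff_mul_div_binomCoeff {a b : ℝ} (ha : 0 < a) (hb : 0 < b) :
    Tendsto (fun n => weightCoeff b n * weightCoeff a n / binomCoeff ((a + b) / 2) n) atTop
      (𝓝 (Real.Gamma ((a + b) / 2) / (Real.sqrt (Real.Gamma b) * Real.sqrt (Real.Gamma a)))) := by
  have hg : 0 < (a + b) / 2 := by linarith
  have hden : Real.sqrt (Real.Gamma b) * Real.sqrt (Real.Gamma a) ≠ 0 :=
    (mul_pos (Real.sqrt_pos.2 (Real.Gamma_pos_of_pos hb))
      (Real.sqrt_pos.2 (Real.Gamma_pos_of_pos ha))).ne'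
  rw [← tendsto_add_atTop_iff_nat 1]
  refine ((Real.GammaSeq_tendsto_Gamma ((a + b) / 2)).div ((Real.GammaSeq_tendsto_Gamma b).sqrt.mul
    (Real.GammaSeq_tendsto_Gamma a).sqrt) hden).congr' ?_
  filter_upwards [eventually_gt_atTop 0] with n hn
  have hn' : (0 : ℝ) < n := by exact_mod_cast hn
  have hG : ∀ {s : ℝ}, 0 < s → 0 < Real.GammaSeq s n := by
    intro s hs
    have h := gammaSeq_mul_binomCoeff_succ hs n
    have h2 : 0 < (n : ℝ) ^ s / (n + 1) := by positivity
    rw [← h] at h2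
    exact pos_of_mul_pos_left h2 (binomCoeff_pos hs _).le
  have hB : ∀ {s : ℝ}, 0 < s → binomCoeff s (n + 1) = (n : ℝ) ^ s / (n + 1) / Real.GammaSeq s n := by
    intro s hs
    rw [← gammaSeq_mul_binomCoeff_succ hs, mul_comm, mul_div_cancel_right₀ _ (hG hs).ne']
  have hab : (n : ℝ) ^ b / (n + 1) * ((n : ℝ) ^ a / (n + 1)) =
      ((n : ℝ) ^ ((a + b) / 2) / (n + 1)) ^ 2 := by
    have : (n : ℝ) ^ b * (n : ℝ) ^ a = ((n : ℝ) ^ ((a + b) / 2)) ^ 2 := by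
      rw [← Real.rpow_add hn', ← Real.rpow_natCast, ← Real.rpow_mul hn'.le]
      congr 1
      push_cast
      ring
    rw [div_pow, ← this, div_mul_div_comm, sq ((n : ℝ) + 1)]
  have hnum : weightCoeff b (n + 1) * weightCoeff a (n + 1) = (n : ℝ) ^ ((a + b) / 2) / (n + 1) /
      (Real.sqrt (Real.GammaSeq b n) * Real.sqrt (Real.GammaSeq a n)) := by
    rw [weightCoeff, weightCoeff, hB ha, hB hb,
      Real.sqrt_div (show 0 ≤ (n : ℝ) ^ b / (n + 1) by positivity),
      Real.sqrt_div (show 0 ≤ (n : ℝ) ^ a / (n + 1) by positivity), div_mul_div_comm, 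
      ← Real.sqrt_mul (by positivity), hab,
      Real.sqrt_sq (by positivity)]
  have h1 := Real.sqrt_pos.2 (hG ha)
  have h2 := Real.sqrt_pos.2 (hG hb)
  have h3 := hG hg
  have h4 : 0 < (n : ℝ) ^ ((a + b) / 2) := by positivity
  rw [hnum, hB hg]
  simp only [Pi.div_apply]
  field_simp

/-- Abel's theorem: coefficients asymptotic to those of `(1 - s) ^ (-g)` give a power series with
the same behaviour when `s` tends to `1` in a Stolz angle. -/
theorem tendsto_tsum_div_cpow {τ : Type*} {l : Filter τ} {g κ M : ℝ} (hg : 0 < g) {c : ℕ → ℝ}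
    (hc : Tendsto (fun n => c n / binomCoeff g n) atTop (𝓝 κ)) {s : τ → ℂ} (hs : ∀ t, ‖s t‖ < 1)
    (h1 : Tendsto s l (𝓝 1)) (hM : ∀ᶠ t in l, ‖1 - s t‖ ≤ M * (1 - ‖s t‖)) :
    Tendsto (fun t => (∑' n, (c n : ℂ) * s t ^ n) / (1 - s t) ^ (-(g : ℂ))) l (𝓝 (κ : ℂ)) := by
  have hb := fun n => binomCoeff_pos hg n
  -- The tail of the error series is dominated by `ε` times the binomial series, and its finitely
  -- many initial terms by a constant `K` independent of `r`.
  have herr : ∀ ε > 0, ∃ K : ℝ, 0 ≤ K ∧ ∀ r : ℝ, 0 ≤ r → r < 1 →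
      Summable (fun n => |c n - κ * binomCoeff g n| * r ^ n) ∧
      ∑' n, |c n - κ * binomCoeff g n| * r ^ n ≤ ε * (1 - r) ^ (-g) + K := by
    intro ε hε
    obtain ⟨N, hN⟩ := Metric.tendsto_atTop.1 hc ε hε
    refine ⟨∑ n ∈ Finset.range N, |c n - κ * binomCoeff g n|, Finset.sum_nonneg fun _ _ =>
      abs_nonneg _, fun r h0 hr => ?_⟩
    have hS := (hasSum_binomCoeff_real g h0 hr).mul_left ε
    have hF : HasSum (fun n => if n ∈ Finset.range N then |c n - κ * binomCoeff g n| else 0)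
        (∑ n ∈ Finset.range N, |c n - κ * binomCoeff g n|) := by
      have := hasSum_sum_of_ne_finset_zero (L := SummationFilter.unconditional ℕ) (s := Finset.range N)
        (f := fun n => if n ∈ Finset.range N then |c n - κ * binomCoeff g n| else 0)
        (fun n hn => if_neg hn)
      rwa [Finset.sum_congr rfl fun n hn => if_pos hn] at this
    have hle : ∀ n, |c n - κ * binomCoeff g n| * r ^ n ≤ ε * (binomCoeff g n * r ^ n) +
        if n ∈ Finset.range N then |c n - κ * binomCoeff g n| else 0 := by
      intro n
      have hr0 : 0 ≤ r ^ n := pow_nonneg h0 n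
      have hr1 : r ^ n ≤ 1 := pow_le_one₀ h0 hr.le
      by_cases hn : n ∈ Finset.range N
      · rw [if_pos hn]
        have := mul_le_of_le_one_right (abs_nonneg (c n - κ * binomCoeff g n)) hr1
        have := mul_nonneg hε.le (mul_nonneg (hb n).le hr0)
        linarith
      · rw [if_neg hn, add_zero, ← mul_assoc]
        refine mul_le_mul_of_nonneg_right ?_ hr0
        have h := (hN n (by simpa using hn)).le
        rw [Real.dist_eq] at h
        have e : c n - κ * binomCoeff g n = (c n / binomCoeff g n - κ) * binomCoeff g n := by
          have := (hb n).ne'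
          field_simp
        rw [e, abs_mul, abs_of_pos (hb n)]
        exact mul_le_mul_of_nonneg_right h (hb n).le
    have hsum := Summable.of_nonneg_of_le
      (fun n => mul_nonneg (abs_nonneg _) (pow_nonneg h0 n)) hle (hS.add hF).summable
    exact ⟨hsum, hasSum_le hle hsum.hasSum (hS.add hF)⟩
  rw [tendsto_iff_norm_sub_tendsto_zero]
  refine tendsto_order.2 ⟨fun x hx => Eventually.of_forall fun t => hx.trans_le (norm_nonneg _),
    fun δ hδ => ?_⟩
  have hM0 : 0 < (|M| + 1) ^ g := by positivity
  -- The Stolz condition loses a factor `(|M| + 1)^g` when `(1 - ‖u‖)^(-g)` is compared with `‖1 -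
  -- u‖^(-g)`; this choice leaves `δ / 2`. The `|M| + 1` avoids assuming `M > 0`.
  obtain ⟨K, hK0, hK⟩ := herr (δ / 2 / (|M| + 1) ^ g) (by positivity)
  have hz : Tendsto (fun t => K * ‖1 - s t‖ ^ g) l (𝓝 0) := by
    have h2 : Tendsto (fun t => ‖1 - s t‖) l (𝓝 0) := by
      simpa using (h1.const_sub 1).norm
    have h3 := (h2.rpow_const (p := g) (Or.inr hg.le)).const_mul K
    rwa [Real.zero_rpow hg.ne', mul_zero] at h3
  filter_upwards [hM, hz.eventually (gt_mem_nhds (show (0 : ℝ) < δ / 2 by positivity))] with t ht1 ht2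
  set u := s t with hu
  have hu1 := hs t
  rw [← hu] at hu1
  have hpos : 0 < 1 - ‖u‖ := by linarith
  have hne : 1 - u ≠ 0 := by
    intro h
    have : u = 1 := by linear_combination -h
    rw [this] at hu1
    simp at hu1
  have hupos : 0 < ‖1 - u‖ := norm_pos_iff.2 hne
  obtain ⟨hsum, hle⟩ := hK ‖u‖ (norm_nonneg _) hu1
  have hE : Summable fun n => ((c n : ℂ) - κ * binomCoeff g n) * u ^ n := by
    refine Summable.of_norm (hsum.congr fun n => ?_)
    rw [norm_mul, norm_pow, ← Real.norm_eq_abs, ← Complex.norm_real]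
    push_cast
    rfl
  have hEn : ‖∑' n, ((c n : ℂ) - κ * binomCoeff g n) * u ^ n‖ ≤
      δ / 2 / (|M| + 1) ^ g * (1 - ‖u‖) ^ (-g) + K := by
    refine (norm_tsum_le_tsum_norm hE.norm).trans (le_trans (le_of_eq ?_) hle)
    refine tsum_congr fun n => ?_
    rw [norm_mul, norm_pow, ← Real.norm_eq_abs, ← Complex.norm_real]
    push_cast
    rfl
  have hB := hasSum_binomCoeff g hu1
  have hcsum : HasSum (fun n => (c n : ℂ) * u ^ n)
      ((∑' n, ((c n : ℂ) - κ * binomCoeff g n) * u ^ n) + κ * (1 - u) ^ (-(g : ℂ))) := by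
    have h := hE.hasSum.add (hB.mul_left (κ : ℂ))
    have e : (fun n => (c n : ℂ) * u ^ n) = fun n =>
        ((c n : ℂ) - κ * binomCoeff g n) * u ^ n + κ * ((binomCoeff g n : ℂ) * u ^ n) := by
      funext n; ring
    rwa [e]
  have hcp : (1 - u) ^ (-(g : ℂ)) ≠ 0 := by
    rw [Ne, Complex.cpow_eq_zero_iff]
    exact fun h => hne h.1
  have hnorm : ‖(1 - u) ^ (-(g : ℂ))‖ = ‖1 - u‖ ^ (-g) := by
    rw [← Complex.ofReal_neg, Complex.norm_cpow_real]
  rw [hcsum.tsum_eq, add_div, mul_div_cancel_right₀ _ hcp, add_sub_cancel_right, norm_div, hnorm,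
    Real.rpow_neg hupos.le, div_inv_eq_mul]
  have hMle : ‖1 - u‖ ^ g ≤ (|M| + 1) ^ g * (1 - ‖u‖) ^ g := by
    rw [← Real.mul_rpow (by positivity) hpos.le]
    refine Real.rpow_le_rpow hupos.le (ht1.trans ?_) hg.le
    exact mul_le_mul_of_nonneg_right (by linarith [le_abs_self M]) hpos.le
  have hp1 : 0 < (1 - ‖u‖) ^ g := Real.rpow_pos_of_pos hpos g
  have hp2 : 0 < ‖1 - u‖ ^ g := Real.rpow_pos_of_pos hupos g
  calc _ ≤ (δ / 2 / (|M| + 1) ^ g * (1 - ‖u‖) ^ (-g) + K) * ‖1 - u‖ ^ g :=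
        mul_le_mul_of_nonneg_right hEn hp2.le
    _ = δ / 2 / (|M| + 1) ^ g * ((1 - ‖u‖) ^ g)⁻¹ * ‖1 - u‖ ^ g + K * ‖1 - u‖ ^ g := by
        rw [Real.rpow_neg hpos.le]; ring
    _ ≤ δ / 2 / (|M| + 1) ^ g * ((1 - ‖u‖) ^ g)⁻¹ * ((|M| + 1) ^ g * (1 - ‖u‖) ^ g) +
        K * ‖1 - u‖ ^ g := by gcongr
    _ = δ / 2 + K * ‖1 - u‖ ^ g := by field_simp
    _ < δ := by linarith

end AbelianTheorem

/-! ### Large-time asymptotics of pairings between different weights. -/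

section Asymptotics

theorem tendsto_add_mul_div {l : Filter ℝ} (hl : Tendsto (fun t : ℝ => t⁻¹) l (𝓝 0))
    (h0 : ∀ᶠ t in l, t ≠ 0) (u c : ℂ) :
    Tendsto (fun t : ℝ => (u + t * c) / t) l (𝓝 c) := by
  have h1 : Tendsto (fun t : ℝ => u * ((t⁻¹ : ℝ) : ℂ) + c) l (𝓝 (u * ((0 : ℝ) : ℂ) + c)) :=
    (((Complex.continuous_ofReal.tendsto 0).comp hl).const_mul u).add_const c
  rw [Complex.ofReal_zero, mul_zero, zero_add] at h1
  refine h1.congr' ?_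
  filter_upwards [h0] with t ht
  have : (t : ℂ) ≠ 0 := by exact_mod_cast ht
  push_cast
  field_simp

/-- Subtracting `log t` from each logarithm leaves the limits `log (-I)` and `log I`. This jump of
the argument is the source of the scattering phase. -/
theorem tendsto_log_sub_log (u v : ℂ) :
    Tendsto (fun t : ℝ => Complex.log (u + t * -Complex.I) - Complex.log (v + t * Complex.I)) atTop
      (𝓝 (-(Real.pi * Complex.I))) := by
  have key : ∀ (u c : ℂ), c ∈ Complex.slitPlane → Tendsto (fun t : ℝ =>
      Complex.log (u + t * c) - Real.log t) atTop (𝓝 (Complex.log c)) := by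
    intro u c hc
    have h1 := tendsto_add_mul_div tendsto_inv_atTop_zero (eventually_ne_atTop 0) u c
    refine ((continuousAt_clog hc).tendsto.comp h1).congr' ?_
    filter_upwards [eventually_gt_atTop 0,
      h1.eventually_ne (Complex.slitPlane_ne_zero hc)] with t ht hne
    have ht' : (t : ℂ) ≠ 0 := by exact_mod_cast ht.ne'
    have h2 := Complex.log_ofReal_mul ht hne
    rw [mul_div_cancel₀ _ ht'] at h2
    rw [h2]
    simp
  have h := (key u (-Complex.I) (by simp [Complex.mem_slitPlane_iff])).sub
    (key v Complex.I (by simp [Complex.mem_slitPlane_iff]))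
  rw [Complex.log_neg_I, Complex.log_I] at h
  have e : -(Real.pi / 2 : ℂ) * Complex.I - Real.pi / 2 * Complex.I = -(Real.pi * Complex.I) := by
    ring
  rw [e] at h
  simpa using h

variable {a b : ℝ} (ha : 0 < a) (hb : 0 < b)

/-- The numerator `conj w + z - 1` of `1 - s` is invariant under the shift, while its denominator
behaves like `(-it)(it) = t²`. -/
theorem tendsto_one_sub_mul_sq {l : Filter ℝ} (hl : Tendsto (fun t : ℝ => t⁻¹) l (𝓝 0))
    (h0 : ∀ᶠ t in l, t ≠ 0) (w z : HalfPlane) :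
    Tendsto (fun t : ℝ => (1 - ((conj (w.shift t : ℂ))⁻¹ - 1) * ((z.shift t : ℂ)⁻¹ - 1)) *
      ((t ^ 2 : ℝ) : ℂ)) l (𝓝 (conj (w : ℂ) + z - 1)) := by
  have h1 := tendsto_add_mul_div hl h0 (conj (w : ℂ)) (-Complex.I)
  have h2 := tendsto_add_mul_div hl h0 (z : ℂ) Complex.I
  have h3 := ((h1.mul h2).inv₀ (by simp)).const_mul (conj (w : ℂ) + z - 1)
  have e : (conj (w : ℂ) + z - 1) * (-Complex.I * Complex.I)⁻¹ = conj (w : ℂ) + z - 1 := by simp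
  rw [e] at h3
  refine h3.congr' ?_
  filter_upwards [h0] with t ht
  have ht' : (t : ℂ) ≠ 0 := by exact_mod_cast ht
  have hw := ne_zero_of_half_lt_re (w.shift t).half_lt_re_conj
  have hz := ne_zero_of_half_lt_re (z.shift t).2
  rw [one_sub_mul_inv_sub_one hw hz]
  have e1 : conj (w.shift t : ℂ) = conj (w : ℂ) + t * -Complex.I := by simp
  have e2 : (z.shift t : ℂ) = z + t * Complex.I := rfl
  rw [e1] at hw ⊢
  rw [e2] at hz ⊢
  push_cast
  field_simp
  ring

/-- Since `1 - u` behaves like `D / t²` with `re D > 0`, the approach to `1` is nontangential. -/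
theorem exists_eventually_norm_one_sub_le {l : Filter ℝ} (h0 : ∀ᶠ t in l, t ≠ 0) {u : ℝ → ℂ} {D : ℂ}
    (hD : 0 < D.re) (hu1 : ∀ t, ‖u t‖ < 1)
    (hu : Tendsto (fun t : ℝ => (1 - u t) * ((t ^ 2 : ℝ) : ℂ)) l (𝓝 D)) (h1 : Tendsto u l (𝓝 1)) :
    ∃ M : ℝ, ∀ᶠ t in l, ‖1 - u t‖ ≤ M * (1 - ‖u t‖) := by
  -- Eventually `‖1 - u‖ t² < ‖D‖ + 1` and `(1 - ‖u‖) t² > D.re / 4`; the constant is the quotient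
  -- of these bounds.
  refine ⟨4 * (‖D‖ + 1) / D.re, ?_⟩
  have hn : ∀ᶠ t in l, ‖(1 - u t) * ((t ^ 2 : ℝ) : ℂ)‖ < ‖D‖ + 1 :=
    hu.norm.eventually (gt_mem_nhds (by linarith))
  have hre : ∀ᶠ t in l, D.re / 2 < ((1 - u t) * ((t ^ 2 : ℝ) : ℂ)).re :=
    ((Complex.continuous_re.tendsto _).comp hu).eventually (lt_mem_nhds (by linarith))
  have hsmall : ∀ᶠ t in l, ‖1 - u t‖ * (‖D‖ + 1) < D.re / 2 := by
    have h2 : Tendsto (fun t => ‖1 - u t‖ * (‖D‖ + 1)) l (𝓝 0) := by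
      simpa using ((h1.const_sub 1).norm).mul_const (‖D‖ + 1)
    exact h2.eventually (gt_mem_nhds (by linarith))
  filter_upwards [hn, hre, hsmall, h0] with t hn hre hsmall ht
  have ht2 : 0 < t ^ 2 := by positivity
  rw [norm_mul, Complex.norm_real, Real.norm_of_nonneg ht2.le] at hn
  rw [Complex.re_mul_ofReal] at hre
  have hsq : ‖u t‖ ^ 2 = 1 - 2 * (1 - u t).re + ‖1 - u t‖ ^ 2 := by
    rw [← Complex.normSq_eq_norm_sq, ← Complex.normSq_eq_norm_sq, Complex.normSq_apply,
      Complex.normSq_apply]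
    simp
    ring
  have hu1 := hu1 t
  have hu0 := norm_nonneg (u t)
  have hd0 := norm_nonneg (1 - u t)
  have hlow : D.re / 4 < (1 - ‖u t‖) * t ^ 2 := by
    have h3 : ‖1 - u t‖ ^ 2 * t ^ 2 ≤ D.re / 2 := by
      have : ‖1 - u t‖ * (‖1 - u t‖ * t ^ 2) ≤ ‖1 - u t‖ * (‖D‖ + 1) :=
        mul_le_mul_of_nonneg_left hn.le hd0
      linarith
    have h4 : (1 - ‖u t‖ ^ 2) * t ^ 2 = 2 * ((1 - u t).re * t ^ 2) - ‖1 - u t‖ ^ 2 * t ^ 2 := by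
      rw [hsq]; ring
    have h5 : (1 - ‖u t‖ ^ 2) * t ^ 2 ≤ 2 * (1 - ‖u t‖) * t ^ 2 := by
      apply mul_le_mul_of_nonneg_right _ ht2.le
      nlinarith
    linarith
  rw [div_mul_eq_mul_div, le_div_iff₀ hD]
  have h6 : ‖1 - u t‖ * D.re * t ^ 2 ≤ 4 * (‖D‖ + 1) * (1 - ‖u t‖) * t ^ 2 := by
    have h7 : ‖1 - u t‖ * t ^ 2 * D.re ≤ (‖D‖ + 1) * D.re := mul_le_mul_of_nonneg_right hn.le hD.le
    have h8 : (‖D‖ + 1) * (D.re / 4) ≤ (‖D‖ + 1) * ((1 - ‖u t‖) * t ^ 2) :=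
      mul_le_mul_of_nonneg_left hlow.le (by positivity)
    linarith
  exact le_of_mul_le_mul_right h6 ht2

/-- The large time behaviour of the matrix elements between coherent vectors of different weights
is governed by the difference of the arguments of the parameters. -/
theorem tendsto_inner_coherent_shift {l : Filter ℝ} (hl : Tendsto (fun t : ℝ => t⁻¹) l (𝓝 0))
    (h0 : ∀ᶠ t in l, t ≠ 0) {θ : ℂ} (w z : HalfPlane)
    (hθ : Tendsto (fun t : ℝ => Complex.log (conj (w : ℂ) + t * -Complex.I) -
      Complex.log (z + t * Complex.I)) l (𝓝 θ)) :
    Tendsto (fun t : ℝ => inner ℂ (coherent hb (w.shift t)) (coherent ha (z.shift t))) l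
      (𝓝 (Complex.exp ((a - b) / 2 * θ) *
        (((Real.Gamma ((a + b) / 2) / (Real.sqrt (Real.Gamma b) * Real.sqrt (Real.Gamma a)) : ℝ) : ℂ)
        * (conj (w : ℂ) + z - 1) ^ (-(((a + b) / 2 : ℝ) : ℂ))))) := by
  set g := (a + b) / 2 with hg
  set D := conj (w : ℂ) + z - 1 with hD
  have hDre : 0 < D.re := by
    have := w.2
    have := z.2
    simp [hD]
    linarith
  set s : ℝ → ℂ := fun t => ((conj (w.shift t : ℂ))⁻¹ - 1) * ((z.shift t : ℂ)⁻¹ - 1) with hs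
  have hs1 : ∀ t, ‖s t‖ < 1 := fun t =>
    norm_mul_inv_sub_one_lt_one (w.shift t).half_lt_re_conj (z.shift t).2
  have hsD : Tendsto (fun t : ℝ => (1 - s t) * ((t ^ 2 : ℝ) : ℂ)) l (𝓝 D) :=
    tendsto_one_sub_mul_sq hl h0 w z
  have hst : Tendsto s l (𝓝 1) := by
    have h1 : Tendsto (fun t : ℝ => (((t⁻¹) ^ 2 : ℝ) : ℂ)) l (𝓝 (((0 : ℝ) ^ 2 : ℝ) : ℂ)) :=
      (Complex.continuous_ofReal.tendsto _).comp (hl.pow 2)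
    have h2 := (hsD.mul h1).const_sub 1
    simp only [ne_eq, OfNat.ofNat_ne_zero, not_false_eq_true, zero_pow, Complex.ofReal_zero,
      mul_zero, sub_zero] at h2
    refine h2.congr' ?_
    filter_upwards [h0] with t ht
    have ht' : (t : ℂ) ≠ 0 := by exact_mod_cast ht
    push_cast
    field_simp
    ring
  obtain ⟨M, hM⟩ := exists_eventually_norm_one_sub_le h0 hDre hs1 hsD hst
  have hA := tendsto_tsum_div_cpow (show 0 < g by linarith)
    (tendsto_weightCoeff_mul_div_binomCoeff ha hb) hs1 hst hM
  have hexp := (Complex.continuous_exp.tendsto _).comp (hθ.const_mul (((a : ℂ) - b) / 2))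
  -- The factorization is exact for every `t`: `D` does not depend on `t`, and after `(1 - s)^(-g)`
  -- is expanded, the surviving powers of the two shifted parameters have exponents `±(a - b) / 2`.
  refine (hexp.mul (hA.mul_const (D ^ (-(g : ℂ))))).congr fun t => ?_
  have hw := (w.shift t).half_lt_re_conj
  have hz := (z.shift t).2
  have hw0 := ne_zero_of_half_lt_re hw
  have hz0 := ne_zero_of_half_lt_re hz
  have hD0 : D ≠ 0 := fun h => by simp [h] at hDre
  have e3 : conj (w.shift t : ℂ) + (z.shift t : ℂ) - 1 = D := by
    simp [hD]
    ring
  rw [inner_coherent_coherent_eq_tsum ha hb]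
  have hcp := one_sub_mul_inv_sub_one_cpow hw hz (g : ℂ)
  rw [e3] at hcp
  have e1 : conj (w.shift t : ℂ) = conj (w : ℂ) + t * -Complex.I := by simp
  have e2 : (z.shift t : ℂ) = z + t * Complex.I := rfl
  simp only [Function.comp, hs]
  rw [hcp]
  rw [← e1, ← e2, mul_sub, Complex.exp_sub]
  have hwg : conj (w.shift t : ℂ) ^ (-(b : ℂ)) * conj (w.shift t : ℂ) ^ (g : ℂ) =
      Complex.exp (((a : ℂ) - b) / 2 * Complex.log (conj (w.shift t : ℂ))) := by
    rw [← Complex.cpow_add _ _ hw0, Complex.cpow_def_of_ne_zero hw0, mul_comm, hg]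
    congr 2
    push_cast
    ring
  have hzg : (z.shift t : ℂ) ^ (-(a : ℂ)) * (z.shift t : ℂ) ^ (g : ℂ) *
      Complex.exp (((a : ℂ) - b) / 2 * Complex.log (z.shift t : ℂ)) = 1 := by
    rw [← Complex.cpow_add _ _ hz0, Complex.cpow_def_of_ne_zero hz0, ← Complex.exp_add, hg,
      ← Complex.exp_zero]
    congr 1
    push_cast
    ring
  have n1 : D ^ (-(g : ℂ)) ≠ 0 :=
    fun h => hD0 ((Complex.cpow_eq_zero_iff _ _).1 h).1
  have n2 : conj (w.shift t : ℂ) ^ (g : ℂ) ≠ 0 :=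
    fun h => hw0 ((Complex.cpow_eq_zero_iff _ _).1 h).1
  have n3 : (z.shift t : ℂ) ^ (g : ℂ) ≠ 0 :=
    fun h => hz0 ((Complex.cpow_eq_zero_iff _ _).1 h).1
  have n4 := Complex.exp_ne_zero (((a : ℂ) - b) / 2 * Complex.log (z.shift t : ℂ))
  rw [← hwg]
  have hzg' : (z.shift t : ℂ) ^ (-(a : ℂ)) = ((z.shift t : ℂ) ^ (g : ℂ) *
      Complex.exp (((a : ℂ) - b) / 2 * Complex.log (z.shift t : ℂ)))⁻¹ := by
    refine eq_inv_of_mul_eq_one_left ?_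
    rw [← mul_assoc]
    exact hzg
  rw [hzg']
  field_simp

end Asymptotics

/-! ### Existence of the wave operators and their phases. -/

section WaveOperators

variable {a b : ℝ}

theorem isWaveOperator_smul_of_tendsto_inner (ha : 0 < a) (hb : 0 < b) {l : Filter ℝ} {c : ℂ}
    (hc : ‖c‖ = 1) (V : EllTwo ≃ₗᵢ[ℂ] EllTwo)
    (h : ∀ w z, Tendsto (fun t : ℝ => inner ℂ (coherent hb (w.shift t)) (coherent ha (z.shift t))) l
      (𝓝 (c * inner ℂ (coherent hb w) (V (coherent ha z))))) :
    IsWaveOperator (laguerreOperator (b - 1)) (laguerreOperator (a - 1)) l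
      (c • V.toLinearIsometry.toContinuousLinearMap) := by
  have hA := isUnitaryGroupOf_unitaryGroup_laguerre ha
  have hB := isUnitaryGroupOf_unitaryGroup_laguerre hb
  refine tendsto_of_tendsto_inner (fun t => unitaryGroup (laguerreOperator (b - 1)) (-t) ∘L
    unitaryGroup (laguerreOperator (a - 1)) t) _ (fun t x => ?_) (fun x => ?_)
    (dense_span_coherent ha) (dense_span_coherent hb) (fun z w => ?_)
  · rw [ContinuousLinearMap.comp_apply, norm_apply_of_mem_unitary (hB.unitary _),
      norm_apply_of_mem_unitary (hA.unitary _)]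
  · rw [smul_apply, norm_smul, hc, one_mul]
    exact V.norm_map x
  -- Conjugation moves the operator to the first slot of the inner product, as
  -- `tendsto_of_tendsto_inner` requires.
  · have h1 := (Complex.continuous_conj.tendsto _).comp (h w z)
    have e : conj (c * inner ℂ (coherent hb w) (V (coherent ha z))) =
        inner ℂ ((c • V.toLinearIsometry.toContinuousLinearMap) (coherent ha z))
          (coherent hb w) := by
      rw [← inner_smul_right, inner_conj_symm]
      rfl
    rw [e] at h1
    refine h1.congr fun t => ?_
    simp only [Function.comp]
    rw [inner_conj_symm, ContinuousLinearMap.comp_apply, hB.inner_apply_neg,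
      unitaryGroup_laguerreOperator_coherent, unitaryGroup_laguerreOperator_coherent]

theorem tendsto_inner_coherent_shift_atTop (ha : 0 < a) (hb : 0 < b) (w z : HalfPlane) :
    Tendsto (fun t : ℝ => inner ℂ (coherent hb (w.shift t)) (coherent ha (z.shift t))) atTop
      (𝓝 (Complex.exp ((a - b) / 2 * -(Real.pi * Complex.I)) *
        (((Real.Gamma ((a + b) / 2) / (Real.sqrt (Real.Gamma b) * Real.sqrt (Real.Gamma a)) : ℝ) : ℂ)
        * (conj (w : ℂ) + z - 1) ^ (-(((a + b) / 2 : ℝ) : ℂ))))) :=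
  tendsto_inner_coherent_shift ha hb tendsto_inv_atTop_zero (eventually_ne_atTop 0) w z
    (tendsto_log_sub_log _ _)

theorem tendsto_inner_coherent_shift_atBot (ha : 0 < a) (hb : 0 < b) (w z : HalfPlane) :
    Tendsto (fun t : ℝ => inner ℂ (coherent hb (w.shift t)) (coherent ha (z.shift t))) atBot
      (𝓝 (Complex.exp ((a - b) / 2 * (Real.pi * Complex.I)) *
        (((Real.Gamma ((a + b) / 2) / (Real.sqrt (Real.Gamma b) * Real.sqrt (Real.Gamma a)) : ℝ) : ℂ)
        * (conj (w : ℂ) + z - 1) ^ (-(((a + b) / 2 : ℝ) : ℂ))))) := by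
  refine tendsto_inner_coherent_shift ha hb tendsto_inv_atBot_zero (eventually_ne_atBot 0) w z ?_
  -- Replacing `t` by `-t` exchanges the roles of `z` and `conj w`, so the limit of the logarithms
  -- changes sign.
  have h := ((tendsto_log_sub_log (z : ℂ) (conj (w : ℂ))).comp tendsto_neg_atBot_atTop).neg
  rw [neg_neg] at h
  refine h.congr fun t => ?_
  simp

end WaveOperators

end

theorem proposition2 (p q : ℝ) (hp : -1 < p) (hq : -1 < q) :
    ∃ Wplus Wminus : EllTwo →L[ℂ] EllTwo,
      IsWaveOperator (laguerreOperator q) (laguerreOperator p) atTop Wplus ∧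
      IsWaveOperator (laguerreOperator q) (laguerreOperator p) atBot Wminus ∧
      ContinuousLinearMap.adjoint Wplus ∘L Wminus =
        Complex.exp (Complex.I * ((p : ℂ) - (q : ℂ)) * (Real.pi : ℂ)) •
          ContinuousLinearMap.id ℂ EllTwo := by
  have ha : 0 < p + 1 := by linarith
  have hb : 0 < q + 1 := by linarith
  obtain ⟨V, hV⟩ := exists_spectralIntertwiner ha hb
  have hnorm : ∀ r : ℝ, ‖Complex.exp (r * Complex.I)‖ = 1 := Complex.norm_exp_ofReal_mul_I
  have e1 : (((p + 1 : ℝ) : ℂ) - ((q + 1 : ℝ) : ℂ)) / 2 * -(Real.pi * Complex.I) =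
      ((-((p - q) / 2 * Real.pi) : ℝ) : ℂ) * Complex.I := by push_cast; ring
  have e2 : (((p + 1 : ℝ) : ℂ) - ((q + 1 : ℝ) : ℂ)) / 2 * (Real.pi * Complex.I) =
      (((p - q) / 2 * Real.pi : ℝ) : ℂ) * Complex.I := by push_cast; ring
  have h1 := isWaveOperator_smul_of_tendsto_inner ha hb
    (hnorm (-((p - q) / 2 * Real.pi))) V (l := atTop) fun w z => by
      rw [hV, ← e1]; exact tendsto_inner_coherent_shift_atTop ha hb w z
  have h2 := isWaveOperator_smul_of_tendsto_inner ha hb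
    (hnorm ((p - q) / 2 * Real.pi)) V (l := atBot) fun w z => by
      rw [hV, ← e2]; exact tendsto_inner_coherent_shift_atBot ha hb w z
  rw [add_sub_cancel_right, add_sub_cancel_right] at h1 h2
  refine ⟨_, _, h1, h2, ?_⟩
  ext1 f
  refine ext_inner_left ℂ fun x => ?_
  rw [ContinuousLinearMap.comp_apply, ContinuousLinearMap.adjoint_inner_right]
  simp only [smul_apply, LinearIsometry.coe_toContinuousLinearMap,
    LinearIsometryEquiv.coe_toLinearIsometry, inner_smul_left, inner_smul_right,
    ContinuousLinearMap.id_apply, V.inner_map_map, ← Complex.exp_conj]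
  -- The adjoint conjugates the phase of `W₊`, so the two half-phases add up instead of cancelling;
  -- `V` has already dropped out by isometry.
  rw [← mul_assoc, ← Complex.exp_add]
  congr 2
  simp only [map_mul, Complex.conj_ofReal, Complex.conj_I]
  push_cast
  ring
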